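/- Let $\mathbf C^2_1$ be $\mathbf C^2$ with the flat metric $\langle z,w\rangle=\mathrm{Re}(-z_1\bar w_1+z_2\bar w_2)$; a vector is lightlike if it is nonzero and $\langle v,v\rangle=0$, and the light cone is $\{z:\langle z,z\rangle=0\}$. Let $M$ be a surface with a smooth immersion $\phi:M\to\mathbf C^2_1$ whose induced metric is nondegenerate. It is called Lagrangian if multiplication by $i$ interchanges its tangent and normal spaces, marginally trapped if its mean curvature vector field $H=\frac12\mathrm{tr}\,h$ is lightlike at each point, and quasi-biharmonic if its bitension field $\tau_2(\phi)=\sum_{j}\langle e_j,e_j\rangle(\nabla^\phi_{e_j}\nabla^\phi_{e_j}-\nabla^\phi_{\nabla_{e_j}e_j})\tau(\phi)$, where $\tau(\phi)=\mathrm{tr}\,\nabla d\phi=2H$ and $(e_j)$ is a local orthonormal frame, is lightlike at each point. Theorem 7. If $\phi:M\to\mathbf C^2_1$ is a quasi-biharmonic marginally trapped Lagrangian surface, then $M$ is locally congruent to $$\phi(x,y)=e^{i\mu y}z(x),$$ that is, around each point of $M$ there are local coordinates $(x,y)$ in which $\phi$ has this form up to a holomorphic isometry of $\mathbf C^2_1$,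 where $\mu$ is a nonzero real number and $z$ is a smooth null curve (i.e. $z'$ is lightlike everywhere) defined on an open interval, lying in the light cone and satisfying $\langle z,iz'\rangle=\mu^{-1}$ and $z''\neq0$ at each point. Conversely, every immersion $\phi(x,y)=e^{i\mu y}z(x)$ with such $\mu$ and $z$, and every surface locally congruent to such immersions, is a quasi-biharmonic marginally trapped Lagrangian immersion. -/

import Mathlib

open scoped Manifold ContDiff

noncomputable section

namespace LorentzSurface

/-- The real coordinate plane in which the charts of a surface take their values. -/
abbrev Plane := EuclideanSpace ℝ (Fin 2)

/-- The space underlying the Lorentzian complex plane `ℂ²₁`. Only the smooth (equivalently, the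
linear) structure of `ℂ × ℂ` is used; the metric is `lorentz` below. -/
abbrev C21 := ℂ × ℂ

/-- The flat metric `⟨z, w⟩ = Re (-z₁ w̄₁ + z₂ w̄₂)` of `ℂ²₁`. -/
def lorentz (z w : C21) : ℝ :=
  (-(z.1 * (starRingEnd ℂ) w.1) + z.2 * (starRingEnd ℂ) w.2).re

/-- A vector is lightlike if it is nonzero and has zero square. -/
def Lightlike (v : C21) : Prop := v ≠ 0 ∧ lorentz v v = 0

/-- The light cone of `ℂ²₁`. -/
def lightCone : Set C21 := {z | lorentz z z = 0}

/-! ### Local formulas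

Here `f : Plane → C21` is a parametrization (used on an open set only), and the metric of the
surface is the one induced by `f`. -/

/-- The partial derivative `∂ᵢ F`. -/
def partialD {V : Type*} [NormedAddCommGroup V] [NormedSpace ℝ V]
    (i : Fin 2) (F : Plane → V) (u : Plane) : V :=
  fderiv ℝ F u (EuclideanSpace.single i 1)

/-- The coefficients `gᵢⱼ = ⟨∂ᵢ f, ∂ⱼ f⟩` of the induced metric. -/
def metric (f : Plane → C21) (u : Plane) : Matrix (Fin 2) (Fin 2) ℝ :=
  Matrix.of fun i j => lorentz (partialD i f u) (partialD j f u)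

/-- The Christoffel symbols `Γᵏᵢⱼ` of the Levi-Civita connection of the induced metric. -/
def christoffel (f : Plane → C21) (k i j : Fin 2) (u : Plane) : ℝ :=
  (1 / 2) * ∑ l, (metric f u)⁻¹ k l *
    (partialD i (fun v => metric f v j l) u + partialD j (fun v => metric f v i l) u
      - partialD l (fun v => metric f v i j) u)

/-- The second covariant derivative
`(∇dF)(∂ᵢ, ∂ⱼ) = ∂ᵢ∂ⱼ F - Γᵏᵢⱼ ∂ₖ F` of a vector-valued map `F` on the surface, with respect to
the induced Levi-Civita connection on the surface and the flat connection of `ℂ²₁`. -/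
def secondCovDeriv (f F : Plane → C21) (i j : Fin 2) (u : Plane) : C21 :=
  partialD i (partialD j F) u - ∑ k, christoffel f k i j u • partialD k F u

/-- The second fundamental form `h(∂ᵢ, ∂ⱼ)`: by the formula of Gauss, the flat derivative
`∂ᵢ∂ⱼ f` minus its tangential part `∇_{∂ᵢ} ∂ⱼ`. -/
def secondFundForm (f : Plane → C21) (i j : Fin 2) (u : Plane) : C21 :=
  secondCovDeriv f f i j u

/-- The mean curvature vector field `H = ½ tr h`. -/
def meanCurvature (f : Plane → C21) (u : Plane) : C21 :=
  (1 / 2 : ℝ) • ∑ i, ∑ j, (metric f u)⁻¹ i j • secondFundForm f i j u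

/-- The trace of `∇dF`, which for an orthonormal frame `eᵢ` is
`∑ ⟨eᵢ, eᵢ⟩ (∇_{eᵢ} ∇_{eᵢ} - ∇_{∇_{eᵢ} eᵢ}) F`. -/
def roughLaplacian (f F : Plane → C21) (u : Plane) : C21 :=
  ∑ i, ∑ j, (metric f u)⁻¹ i j • secondCovDeriv f F i j u

/-- The tension field `τ(f) = tr ∇df`. -/
def tension (f : Plane → C21) : Plane → C21 := roughLaplacian f f

/-- The bitension field
`τ₂(f) = ∑ ⟨eᵢ, eᵢ⟩ ((∇_{eᵢ} ∇_{eᵢ} - ∇_{∇_{eᵢ} eᵢ}) τ + R(τ, df eᵢ) df eᵢ)`, where the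
curvature tensor `R` of the flat ambient space is zero. -/
def bitension (f : Plane → C21) : Plane → C21 := roughLaplacian f (tension f)

/-! ### Immersed surfaces -/

section Surface

variable {M : Type*} [TopologicalSpace M] [ChartedSpace Plane M]

/-- The tangent space of the immersed surface at `p`, as a real subspace of `ℂ²₁`. -/
def tangentPlane (φ : M → C21) (p : M) : Set C21 :=
  Set.range fun v : TangentSpace (𝓡 2) p => (mfderiv (𝓡 2) 𝓘(ℝ, C21) φ p v : C21)

/-- The normal space of the immersed surface at `p`. -/
def normalPlane (φ : M → C21) (p : M) : Set C21 :=
  {ξ | ∀ w ∈ tangentPlane φ p, lorentz ξ w = 0}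

/-- `φ` is a smooth immersion whose induced metric is nondegenerate, so that `M` with the induced
metric is an isometrically immersed pseudo-Riemannian surface. -/
structure IsPseudoRiemannianImmersion (φ : M → C21) : Prop where
  smooth : ContMDiff (𝓡 2) 𝓘(ℝ, C21) ∞ φ
  immersive : ∀ p, Function.Injective (mfderiv (𝓡 2) 𝓘(ℝ, C21) φ p)
  nondegenerate : ∀ p, ∀ w ∈ tangentPlane φ p,
    (∀ w' ∈ tangentPlane φ p, lorentz w w' = 0) → w = 0

/-- Multiplication by `i` interchanges the tangent and the normal spaces. -/
def IsLagrangian (φ : M → C21) : Prop :=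
  ∀ p, (fun w : C21 => Complex.I • w) '' tangentPlane φ p = normalPlane φ p ∧
    (fun w : C21 => Complex.I • w) '' normalPlane φ p = tangentPlane φ p

/-- The mean curvature vector field is lightlike at each point (computed in any chart of the
smooth structure). -/
def IsMarginallyTrapped (φ : M → C21) : Prop :=
  ∀ e ∈ IsManifold.maximalAtlas (𝓡 2) ∞ M, ∀ u ∈ e.target,
    Lightlike (meanCurvature (φ ∘ e.symm) u)

/-- The bitension field is lightlike at each point (computed in any chart of the smooth
structure). -/
def IsQuasiBiharmonic (φ : M → C21) : Prop :=
  ∀ e ∈ IsManifold.maximalAtlas (𝓡 2) ∞ M, ∀ u ∈ e.target,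
    Lightlike (bitension (φ ∘ e.symm) u)

/-- `φ` is a quasi-biharmonic marginally trapped Lagrangian (isometric) immersion. -/
structure IsQBMTLagrangian (φ : M → C21) : Prop where
  immersion : IsPseudoRiemannianImmersion φ
  lagrangian : IsLagrangian φ
  marginallyTrapped : IsMarginallyTrapped φ
  quasiBiharmonic : IsQuasiBiharmonic φ

end Surface

/-! ### The model surfaces -/

/-- `z` is a smooth null curve in the light cone, defined on the open interval `I`, with
`⟨z, i z'⟩ = μ⁻¹` and `z'' ≠ 0` at each point. -/
structure IsGeneratingCurve (μ : ℝ) (I : Set ℝ) (z : ℝ → C21) : Prop where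
  isOpen : IsOpen I
  interval : I.OrdConnected
  smooth : ContDiffOn ℝ ∞ z I
  null : ∀ x ∈ I, Lightlike (deriv z x)
  mem_lightCone : ∀ x ∈ I, z x ∈ lightCone
  normalized : ∀ x ∈ I, lorentz (z x) (Complex.I • deriv z x) = μ⁻¹
  second_ne_zero : ∀ x ∈ I, deriv (deriv z) x ≠ 0

/-- The map `(x, y) ↦ e^{iμy} z(x)`. -/
def model (μ : ℝ) (z : ℝ → C21) (u : Plane) : C21 :=
  Complex.exp (Complex.I * (μ : ℂ) * (u 1 : ℂ)) • z (u 0)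

/-- A holomorphic isometry of `ℂ²₁`: a complex linear isometry followed by a translation. -/
def IsHolomorphicIsometry (A : C21 → C21) : Prop :=
  ∃ (L : C21 ≃ₗ[ℂ] C21) (b : C21),
    (∀ v w, lorentz (L v) (L w) = lorentz v w) ∧ ∀ v, A v = L v + b

/-- Around each point there are local coordinates `(x, y)` of the smooth structure in which `φ`
agrees, up to a holomorphic isometry of `ℂ²₁`, with some `e^{iμy} z(x)` as above. -/
def LocallyCongruentToModel {M : Type*} [TopologicalSpace M] [ChartedSpace Plane M]
    (φ : M → C21) : Prop :=
  ∀ p : M, ∃ e ∈ IsManifold.maximalAtlas (𝓡 2) ∞ M, p ∈ e.source ∧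
    ∃ (μ : ℝ) (I : Set ℝ) (z : ℝ → C21) (A : C21 → C21),
      μ ≠ 0 ∧ IsGeneratingCurve μ I z ∧ IsHolomorphicIsometry A ∧
      ∀ u ∈ e.target, u 0 ∈ I ∧ φ (e.symm u) = A (model μ z u)

end LorentzSurface

end

/-!
Both directions rest on a moving frame computation. A marginally trapped Lagrangian surface carries
a distinguished null tangent field `e₁ = i H`; completing it to a null frame with `⟨e₁, e₂⟩ = -1`,
and writing `df = p e₁ + q e₂` with the dual coframe `p`, `q`, the pair `e₁`, `e₂` is also a complex
basis of `ℂ²₁`, so that the derivatives of the frame have complex coefficients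
(`IsAdaptedFrameOn`). The total symmetry of the second fundamental form and the normalization
`H = -i e₁` leave
  `∇e₁ = θ e₁`, `h(e₁, e₁) = λ i e₂`, `h(e₁, e₂) = i e₁`, `h(e₂, e₂) = m i e₁ + i e₂`.

All further relations come from the equality of mixed second derivatives of `f`, `e₁` and `e₂`
(`mixed_partials_in_frame`): they contain the equations of Gauss and Codazzi, and give in
particular `θ = w q`, `dq = 0`, `dp = -θ ∧ p`, `dw ∧ q = λ m q ∧ p` and
`dm ∧ q = -w q ∧ p`. In such a coframe the induced Laplacian has a simple expression
(`IsNullCoframeAt.roughLaplacian_eq`), which yields `τ(f) = -2 i e₁` and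
`τ₂(f) = -4 (i λ m e₁ + λ (w + i) e₂)`. The square of the latter is `-32 λ² m`, so `τ₂` is lightlike
exactly when `λ ≠ 0` and `m = 0` (`IsAdaptedFrameOn.lightlike_bitension_iff`).

If `m = 0` identically then `w = 0`, so `p = dx` and `q = dy` are closed and define local
coordinates. In these `∂_y e₂ = i e₂` and `∂_x e₂ = i e₁`, whence `f + i e₂` is constant and
`z = e^{-iy} (-i e₂)` depends on `x` only; it is the generating curve, with `μ = 1`. Conversely, a
generating curve satisfies `z'' = ρ μ z` with `ρ` real, so that `μ e^{iμy} z'` and `i e^{iμy} z`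
form an adapted frame of `e^{iμy} z(x)` with `w = m = 0` and `λ = -ρ μ³ ≠ 0`. Since the frame formalism
works with an arbitrary coframe, this frame may be read in every chart of the surface, and no
separate proof of the coordinate invariance of the bitension field is needed.
-/

noncomputable section

namespace LorentzSurface

open Filter Topology ComplexConjugate

/-! ### Hermitian algebra of null pairs -/

/-- The Hermitian form `-z₁ w̄₁ + z₂ w̄₂`, whose real part is `lorentz`. -/
def herm (z w : C21) : ℂ := -(z.1 * conj w.1) + z.2 * conj w.2

lemma lorentz_eq_re_herm (z w : C21) : lorentz z w = (herm z w).re := rfl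

lemma herm_add_left (x y w : C21) : herm (x + y) w = herm x w + herm y w := by
  simp [herm]; ring

lemma herm_add_right (w x y : C21) : herm w (x + y) = herm w x + herm w y := by
  simp [herm]; ring

lemma herm_smul_left (c : ℂ) (x w : C21) : herm (c • x) w = c * herm x w := by
  simp [herm]; ring

lemma herm_smul_right (c : ℂ) (x w : C21) : herm x (c • w) = conj c * herm x w := by
  simp [herm]; ring

lemma herm_real_smul_left (c : ℝ) (x w : C21) : herm (c • x) w = c * herm x w := by
  simp [herm]; ring

lemma herm_real_smul_right (c : ℝ) (x w : C21) : herm x (c • w) = c * herm x w := by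
  simp [herm]; ring

lemma herm_conj (x y : C21) : conj (herm x y) = herm y x := by
  simp [herm]; ring

lemma herm_zero_left (w : C21) : herm 0 w = 0 := by simp [herm]

lemma herm_zero_right (w : C21) : herm w 0 = 0 := by simp [herm]

lemma herm_self_im (x : C21) : (herm x x).im = 0 := by
  simp [herm]; ring

lemma lorentz_self_eq_zero_iff (x : C21) : lorentz x x = 0 ↔ herm x x = 0 := by
  rw [lorentz_eq_re_herm]
  constructor
  · intro h; exact Complex.ext h (herm_self_im x)
  · intro h; rw [h]; rfl

lemma lorentz_comm (x y : C21) : lorentz x y = lorentz y x := by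
  simp [lorentz]; ring

lemma lorentz_add_left (x y w : C21) : lorentz (x + y) w = lorentz x w + lorentz y w := by
  simp [lorentz_eq_re_herm, herm_add_left]

lemma lorentz_smul_left (c : ℝ) (x w : C21) : lorentz (c • x) w = c * lorentz x w := by
  simp [lorentz_eq_re_herm, herm_real_smul_left]

lemma lorentz_add_right (x y w : C21) : lorentz w (x + y) = lorentz w x + lorentz w y := by
  simp [lorentz_eq_re_herm, herm_add_right]

lemma lorentz_smul_right (c : ℝ) (x w : C21) : lorentz w (c • x) = c * lorentz w x := by
  simp [lorentz_eq_re_herm, herm_real_smul_right]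

lemma lorentz_I_smul_left (x y : C21) : lorentz (Complex.I • x) y = -(herm x y).im := by
  simp [lorentz_eq_re_herm, herm_smul_left]

lemma lorentz_I_smul_I_smul (x y : C21) :
    lorentz (Complex.I • x) (Complex.I • y) = lorentz x y := by
  simp [lorentz_eq_re_herm, herm_smul_left, herm_smul_right]

/-- The Hermitian form as a continuous real bilinear map. -/
def hermL : C21 →L[ℝ] C21 →L[ℝ] ℂ :=
  (LinearMap.mk₂ ℝ herm herm_add_left
    (fun c x y => by rw [herm_real_smul_left]; simp) herm_add_right
    (fun c x y => by rw [herm_real_smul_right]; simp)).toContinuousBilinearMap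

lemma hermL_apply (x y : C21) : hermL x y = herm x y := rfl

/-- Two null vectors of `ℂ²₁` whose Hermitian product is `-1`. They form a complex basis, and
their real span is a Lagrangian plane of signature `(1, 1)`. -/
structure IsNullPair (a b : C21) : Prop where
  left_null : herm a a = 0
  right_null : herm b b = 0
  pairing : herm a b = -1

namespace IsNullPair

variable {a b : C21} (h : IsNullPair a b)
include h

lemma pairing_symm : herm b a = -1 := by
  rw [← herm_conj, h.pairing]; simp

lemma eq_zero_of_herm {w : C21} (ha : herm w a = 0) (hb : herm w b = 0) : w = 0 := by
  have h1 := h.left_null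
  have h2 := h.right_null
  have h3 := h.pairing
  have h4 := h.pairing_symm
  simp only [herm] at h1 h2 h3 h4 ha hb
  -- the Gram determinant of `a, b` is `-|det (a, b)|²`
  have hD : (a.1 * b.2 - a.2 * b.1) * (conj a.1 * conj b.2 - conj a.2 * conj b.1) = 1 := by
    linear_combination (-b.2 * conj b.2 + b.1 * conj b.1) * h1 +
      (-b.1 * conj a.1 + b.2 * conj a.2) * h3 - h4
  have hD' : conj a.1 * conj b.2 - conj a.2 * conj b.1 ≠ 0 := by
    intro h0; rw [h0] at hD; simp at hD
  have e1 : w.1 * (conj a.1 * conj b.2 - conj a.2 * conj b.1) = 0 := by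
    linear_combination -(conj b.2) * ha + conj a.2 * hb
  have e2 : w.2 * (conj a.1 * conj b.2 - conj a.2 * conj b.1) = 0 := by
    linear_combination -(conj b.1) * ha + conj a.1 * hb
  exact Prod.ext ((mul_eq_zero.1 e1).resolve_right hD') ((mul_eq_zero.1 e2).resolve_right hD')

lemma decomp (v : C21) : v = (-herm v b) • a + (-herm v a) • b := by
  rw [← sub_eq_zero, sub_eq_add_neg, ← neg_one_smul ℂ ((-herm v b) • a + (-herm v a) • b)]
  apply h.eq_zero_of_herm <;>
  simp only [herm_add_left, herm_smul_left, h.left_null, h.right_null, h.pairing,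
    h.pairing_symm] <;> ring

lemma ext_herm {v w : C21} (ha : herm v a = herm w a) (hb : herm v b = herm w b) : v = w := by
  rw [h.decomp v, h.decomp w, ha, hb]

lemma herm_comb_left (s t : ℂ) : herm (s • a + t • b) a = -t := by
  simp [herm_add_left, herm_smul_left, h.left_null, h.pairing_symm]

lemma herm_comb_right (s t : ℂ) : herm (s • a + t • b) b = -s := by
  simp [herm_add_left, herm_smul_left, h.right_null, h.pairing]

lemma coeff_eq {s t s' t' : ℂ} (he : s • a + t • b = s' • a + t' • b) : s = s' ∧ t = t' := by
  have h1 := h.herm_comb_left s t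
  have h2 := h.herm_comb_right s t
  rw [he, h.herm_comb_left] at h1
  rw [he, h.herm_comb_right] at h2
  exact ⟨(neg_injective h2).symm, (neg_injective h1).symm⟩

lemma herm_comb_self (s t : ℂ) :
    herm (s • a + t • b) (s • a + t • b) = -(s * conj t) - conj s * t := by
  simp only [herm_add_left, herm_smul_left, herm_add_right, herm_smul_right,
    h.left_null, h.right_null, h.pairing, h.pairing_symm]
  ring

lemma left_ne_zero : a ≠ 0 := by
  rintro rfl; simpa [herm_zero_left] using h.pairing

lemma right_ne_zero : b ≠ 0 := by
  rintro rfl; simpa [herm_zero_right] using h.pairing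

end IsNullPair

/-! ### Partial derivatives of smooth maps -/

section PartialD

variable {V W : Type*} [NormedAddCommGroup V] [NormedSpace ℝ V]
  [NormedAddCommGroup W] [NormedSpace ℝ W] {u : Plane} {i j : Fin 2}

lemma partialD_congr {F G : Plane → V} (h : F =ᶠ[𝓝 u] G) : partialD i F u = partialD i G u := by
  rw [partialD, h.fderiv_eq, partialD]

lemma partialD_const (c : V) : partialD i (fun _ => c) u = 0 := by
  simp [partialD]

lemma partialD_add {F G : Plane → V} (hF : DifferentiableAt ℝ F u) (hG : DifferentiableAt ℝ G u) :
    partialD i (fun v => F v + G v) u = partialD i F u + partialD i G u := by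
  simp [partialD, fderiv_fun_add hF hG]

lemma partialD_neg (F : Plane → V) :
    partialD i (fun v => -F v) u = -partialD i F u := by
  simp [partialD, fderiv_fun_neg]

lemma partialD_const_smul {R : Type*} [NormedField R] [NormedAlgebra ℝ R] [NormedSpace R V]
    [IsScalarTower ℝ R V] {F : Plane → V} (c : R)
    (hF : DifferentiableAt ℝ F u) :
    partialD i (fun v => c • F v) u = c • partialD i F u := by
  simp [partialD, fderiv_fun_const_smul hF]

lemma partialD_smul {R : Type*} [NormedField R] [NormedAlgebra ℝ R] [NormedSpace R V]
    [IsScalarTower ℝ R V] {c : Plane → R} {F : Plane → V}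
    (hc : DifferentiableAt ℝ c u) (hF : DifferentiableAt ℝ F u) :
    partialD i (fun v => c v • F v) u = c u • partialD i F u + partialD i c u • F u := by
  simp [partialD, fderiv_fun_smul hc hF]

lemma partialD_mul {c d : Plane → ℝ} (hc : DifferentiableAt ℝ c u) (hd : DifferentiableAt ℝ d u) :
    partialD i (fun v => c v * d v) u = c u * partialD i d u + partialD i c u * d u := by
  simpa using partialD_smul hc hd

lemma partialD_clm (L : V →L[ℝ] W) {F : Plane → V} (hF : DifferentiableAt ℝ F u) :
    partialD i (fun v => L (F v)) u = L (partialD i F u) := by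
  rw [partialD, partialD]
  have := (L.hasFDerivAt.comp u hF.hasFDerivAt).fderiv
  simp only [Function.comp_def] at this
  rw [this]; rfl

lemma partialD_herm {F G : Plane → C21} (hF : DifferentiableAt ℝ F u)
    (hG : DifferentiableAt ℝ G u) :
    partialD i (fun v => herm (F v) (G v)) u =
      herm (partialD i F u) (G u) + herm (F u) (partialD i G u) := by
  have := (hermL.hasFDerivAt_of_bilinear hF.hasFDerivAt hG.hasFDerivAt).fderiv
  simp only [hermL_apply] at this
  rw [partialD, this]
  simp [partialD, hermL_apply, add_comm]

lemma contDiffAt_partialD {F : Plane → V} (hF : ContDiffAt ℝ ∞ F u) :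
    ContDiffAt ℝ ∞ (partialD i F) u :=
  (hF.fderiv_right (m := ∞) (by simp)).clm_apply contDiffAt_const

lemma contDiffAt_herm {F G : Plane → C21} (hF : ContDiffAt ℝ ∞ F u) (hG : ContDiffAt ℝ ∞ G u) :
    ContDiffAt ℝ ∞ (fun v => herm (F v) (G v)) u :=
  hermL.isBoundedBilinearMap.contDiff.contDiffAt.comp u (hF.prodMk hG)

lemma contDiffAt_lorentz {F G : Plane → C21} (hF : ContDiffAt ℝ ∞ F u)
    (hG : ContDiffAt ℝ ∞ G u) : ContDiffAt ℝ ∞ (fun v => lorentz (F v) (G v)) u :=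
  Complex.reCLM.contDiff.contDiffAt.comp u (contDiffAt_herm hF hG)

lemma partialD_lorentz {F G : Plane → C21} (hF : DifferentiableAt ℝ F u)
    (hG : DifferentiableAt ℝ G u) :
    partialD i (fun v => lorentz (F v) (G v)) u =
      lorentz (partialD i F u) (G u) + lorentz (F u) (partialD i G u) := by
  have hd : DifferentiableAt ℝ (fun v => herm (F v) (G v)) u := by
    have := (hermL.hasFDerivAt_of_bilinear hF.hasFDerivAt hG.hasFDerivAt).differentiableAt
    simpa only [hermL_apply] using this
  have := partialD_clm (i := i) Complex.reCLM hd
  rw [partialD_herm hF hG] at this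
  simpa [lorentz_eq_re_herm] using this

lemma differentiableAt_of_smooth {F : Plane → V} (hF : ContDiffAt ℝ ∞ F u) :
    DifferentiableAt ℝ F u := hF.differentiableAt (by simp)

lemma partialD_comm {F : Plane → V} (hF : ContDiffAt ℝ ∞ F u) :
    partialD i (partialD j F) u = partialD j (partialD i F) u := by
  have h2 := hF.isSymmSndFDerivAt (by
    rw [minSmoothness_of_isRCLikeNormedField]; exact WithTop.coe_le_coe.2 le_top)
  have hd : DifferentiableAt ℝ (fderiv ℝ F) u :=
    (hF.fderiv_right (m := ∞) (by simp)).differentiableAt (by simp)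
  have key : ∀ k l : Fin 2, partialD k (partialD l F) u =
      fderiv ℝ (fderiv ℝ F) u (EuclideanSpace.single k 1) (EuclideanSpace.single l 1) := by
    intro k l
    have : partialD l F = fun v => fderiv ℝ F v (EuclideanSpace.single l 1) := rfl
    rw [partialD, this, fderiv_clm_apply hd (by fun_prop)]
    simp
  rw [key, key]
  exact h2 _ _

lemma fderiv_eq_sum_partialD {F : Plane → V} (v : Plane) :
    fderiv ℝ F u v = v 0 • partialD 0 F u + v 1 • partialD 1 F u := by
  have hv : v = v 0 • EuclideanSpace.single 0 1 + v 1 • EuclideanSpace.single 1 1 := by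
    ext k; fin_cases k <;> simp
  conv_lhs => rw [hv]
  simp [partialD]

end PartialD

/-! ### The induced Laplacian in a null coframe -/

/-- At the point `u`, the induced metric of `f` is `-(p ⊗ q + q ⊗ p)` for a coframe of null
`1`-forms `p`, `q` with components `p i`, `q i`, and the numbers `θ i` are the components of the
connection form of the Levi-Civita connection: `dp = -θ ∧ p` and `dq = θ ∧ q`. -/
structure IsNullCoframeAt (f : Plane → C21) (p q : Fin 2 → Plane → ℝ) (θ : Fin 2 → ℝ)
    (u : Plane) : Prop where
  metric_eq : ∀ᶠ v in 𝓝 u, ∀ i j, metric f v i j = -(p i v * q j v + q i v * p j v)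
  diff_left : ∀ i, DifferentiableAt ℝ (p i) u
  diff_right : ∀ i, DifferentiableAt ℝ (q i) u
  structure_left : ∀ i j, partialD i (p j) u - partialD j (p i) u
    = -(θ i * p j u - θ j * p i u)
  structure_right : ∀ i j, partialD i (q j) u - partialD j (q i) u
    = θ i * q j u - θ j * q i u
  det_ne_zero : p 0 u * q 1 u - p 1 u * q 0 u ≠ 0

namespace IsNullCoframeAt

variable {f : Plane → C21} {p q : Fin 2 → Plane → ℝ} {θ : Fin 2 → ℝ} {u : Plane}
  (h : IsNullCoframeAt f p q θ u)
include h

lemma metric_eq_self (i j : Fin 2) : metric f u i j = -(p i u * q j u + q i u * p j u) :=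
  h.metric_eq.self_of_nhds i j

lemma metric_inv :
    (metric f u)⁻¹ = (p 0 u * q 1 u - p 1 u * q 0 u)⁻¹ ^ 2 •
      !![2 * p 1 u * q 1 u, -(p 0 u * q 1 u + p 1 u * q 0 u);
        -(p 0 u * q 1 u + p 1 u * q 0 u), 2 * p 0 u * q 0 u] := by
  have hd := mul_inv_cancel₀ h.det_ne_zero
  generalize (p 0 u * q 1 u - p 1 u * q 0 u)⁻¹ = d at hd
  apply Matrix.inv_eq_right_inv
  ext i j
  rw [Matrix.mul_apply, Fin.sum_univ_two, h.metric_eq_self, h.metric_eq_self]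
  fin_cases i <;> fin_cases j <;> simp
  · linear_combination ((p 0 u * q 1 u - p 1 u * q 0 u) * d + 1) * hd
  · ring
  · ring
  · linear_combination ((p 0 u * q 1 u - p 1 u * q 0 u) * d + 1) * hd

/-- The trace with respect to the metric only sees the mixed components. -/
lemma sum_metric_inv (A B C D : C21) :
    ∑ i, ∑ j, (metric f u)⁻¹ i j •
      (p j u • (p i u • A + q i u • B) + q j u • (p i u • C + q i u • D)) = -(B + C) := by
  have hd := h.det_ne_zero
  rw [h.metric_inv]
  simp only [Fin.sum_univ_two, Matrix.smul_apply, Matrix.of_apply, Matrix.cons_val', smul_eq_mul,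
    Matrix.cons_val_zero, Matrix.cons_val_one, Matrix.cons_val_fin_one, smul_add, smul_smul]
  match_scalars <;> field_simp <;> ring

lemma partialD_metric (l i j : Fin 2) : partialD l (fun v => metric f v i j) u =
    -(p i u * partialD l (q j) u + partialD l (p i) u * q j u
      + (q i u * partialD l (p j) u + partialD l (q i) u * p j u)) := by
  have e : (fun v => metric f v i j) =ᶠ[𝓝 u] fun v => -(p i v * q j v + q i v * p j v) :=
    h.metric_eq.mono fun v hv => hv i j
  rw [partialD_congr e, partialD_neg, partialD_add, partialD_mul (h.diff_left i) (h.diff_right j),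
    partialD_mul (h.diff_right i) (h.diff_left j)]
  · exact (h.diff_left i).mul (h.diff_right j)
  · exact (h.diff_right i).mul (h.diff_left j)

lemma christoffel_eq (k i j : Fin 2) : christoffel f k i j u =
    ∑ l, (metric f u)⁻¹ k l *
      -(p l u * (partialD i (q j) u - θ i * q j u)
        + q l u * (partialD i (p j) u + θ i * p j u)) := by
  rw [christoffel, Finset.mul_sum]
  refine Finset.sum_congr rfl fun l _ => ?_
  rw [mul_left_comm]
  congr 1
  rw [h.partialD_metric, h.partialD_metric, h.partialD_metric]
  linear_combination (1 / 2) * (- p j u * h.structure_right i l - q j u * h.structure_left i l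
    - p i u * h.structure_right j l - q i u * h.structure_left j l
    + p l u * h.structure_right i j + q l u * h.structure_left i j)

lemma sum_christoffel_left (i j : Fin 2) :
    ∑ k, christoffel f k i j u * p k u = partialD i (p j) u + θ i * p j u := by
  have hd := h.det_ne_zero
  simp only [h.christoffel_eq, h.metric_inv, Fin.sum_univ_two]
  simp
  field_simp
  ring

lemma sum_christoffel_right (i j : Fin 2) :
    ∑ k, christoffel f k i j u * q k u = partialD i (q j) u - θ i * q j u := by
  have hd := h.det_ne_zero
  simp only [h.christoffel_eq, h.metric_inv, Fin.sum_univ_two]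
  simp
  field_simp
  ring

/-- If `dF = F₁ p + F₂ q`, then `∇dF = p ⊗ (dF₁ - F₁ θ) + q ⊗ (dF₂ + F₂ θ)`. -/
lemma secondCovDeriv_eq {F F₁ F₂ : Plane → C21}
    (hF : ∀ᶠ v in 𝓝 u, ∀ i, partialD i F v = p i v • F₁ v + q i v • F₂ v)
    (h₁ : DifferentiableAt ℝ F₁ u) (h₂ : DifferentiableAt ℝ F₂ u) (i j : Fin 2) :
    secondCovDeriv f F i j u = p j u • (partialD i F₁ u - θ i • F₁ u)
      + q j u • (partialD i F₂ u + θ i • F₂ u) := by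
  have e : partialD j F =ᶠ[𝓝 u] fun v => p j v • F₁ v + q j v • F₂ v :=
    hF.mono fun v hv => hv j
  have hs : ∑ k, christoffel f k i j u • partialD k F u =
      (∑ k, christoffel f k i j u * p k u) • F₁ u
      + (∑ k, christoffel f k i j u * q k u) • F₂ u := by
    simp only [hF.self_of_nhds, Fin.sum_univ_two]
    module
  rw [secondCovDeriv, hs, h.sum_christoffel_left, h.sum_christoffel_right, partialD_congr e,
    partialD_add ((h.diff_left j).fun_smul h₁) ((h.diff_right j).fun_smul h₂),
    partialD_smul (h.diff_left j) h₁, partialD_smul (h.diff_right j) h₂]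
  module

/-- The Laplacian of `F` in a null coframe, where `dF = F₁ p + F₂ q`,
`dF₁ - F₁ θ = A p + B q` and `dF₂ + F₂ θ = C p + D q`. -/
lemma roughLaplacian_eq {F F₁ F₂ : Plane → C21} {A B C D : C21}
    (hF : ∀ᶠ v in 𝓝 u, ∀ i, partialD i F v = p i v • F₁ v + q i v • F₂ v)
    (h₁ : DifferentiableAt ℝ F₁ u) (h₂ : DifferentiableAt ℝ F₂ u)
    (hAB : ∀ i, partialD i F₁ u - θ i • F₁ u = p i u • A + q i u • B)
    (hCD : ∀ i, partialD i F₂ u + θ i • F₂ u = p i u • C + q i u • D) :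
    roughLaplacian f F u = -(B + C) := by
  rw [← h.sum_metric_inv A B C D, roughLaplacian]
  simp only [h.secondCovDeriv_eq hF h₁ h₂, hAB, hCD]

end IsNullCoframeAt

lemma tension_eq (f : Plane → C21) (u : Plane) : tension f u = (2 : ℝ) • meanCurvature f u := by
  simp [tension, roughLaplacian, meanCurvature, secondFundForm, smul_smul]

/-- If the coframe comes from a null frame `e₁`, `e₂` along the immersion, the metric has the
form required of a null coframe. -/
lemma metric_eq_of_isNullPair {f : Plane → C21} {v : Plane} {p q : Fin 2 → ℝ} {a b : C21}
    (hf : ∀ i, partialD i f v = p i • a + q i • b) (h : IsNullPair a b) (i j : Fin 2) :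
    metric f v i j = -(p i * q j + q i * p j) := by
  rw [metric, Matrix.of_apply, hf, hf, lorentz_eq_re_herm]
  simp only [herm_add_left, herm_add_right, herm_real_smul_left, herm_real_smul_right,
    h.left_null, h.right_null, h.pairing, h.pairing_symm]
  simp
  ring

/-! ### Adapted frames: structure equations and bitension -/

section ComplexMk

variable {r s : Plane → ℝ} {u : Plane} {i : Fin 2}

lemma contDiffAt_complexMk (hr : ContDiffAt ℝ ∞ r u) (hs : ContDiffAt ℝ ∞ s u) :
    ContDiffAt ℝ ∞ (fun v => (⟨r v, s v⟩ : ℂ)) u :=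
  Complex.equivRealProdCLM.symm.contDiff.contDiffAt.comp u (hr.prodMk hs)

lemma partialD_complexMk (hr : DifferentiableAt ℝ r u) (hs : DifferentiableAt ℝ s u) :
    partialD i (fun v => (⟨r v, s v⟩ : ℂ)) u = ⟨partialD i r u, partialD i s u⟩ := by
  have h := partialD_clm (i := i) Complex.equivRealProdCLM.symm.toContinuousLinearMap
    (hr.prodMk hs)
  have h2 : partialD i (fun v => (r v, s v)) u = (partialD i r u, partialD i s u) := by
    rw [partialD, (hr.hasFDerivAt.prodMk hs.hasFDerivAt).fderiv]; rfl
  rw [h2] at h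
  exact h

end ComplexMk

/-- The equality of mixed second derivatives of `F`, expressed in a moving frame `a`, `b`. -/
lemma mixed_partials_in_frame {F a b : Plane → C21} {u : Plane} {r s t o : Fin 2 → Plane → ℝ}
    {A B C D : Fin 2 → ℂ} (hF : ContDiffAt ℝ ∞ F u) (hab : IsNullPair (a u) (b u))
    (ha : DifferentiableAt ℝ a u) (hb : DifferentiableAt ℝ b u)
    (hr : ∀ i, ContDiffAt ℝ ∞ (r i) u) (hs : ∀ i, ContDiffAt ℝ ∞ (s i) u)
    (ht : ∀ i, ContDiffAt ℝ ∞ (t i) u) (ho : ∀ i, ContDiffAt ℝ ∞ (o i) u)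
    (hdF : ∀ᶠ v in 𝓝 u, ∀ i, partialD i F v =
      (⟨r i v, s i v⟩ : ℂ) • a v + (⟨t i v, o i v⟩ : ℂ) • b v)
    (hda : ∀ i, partialD i a u = A i • a u + B i • b u)
    (hdb : ∀ i, partialD i b u = C i • a u + D i • b u) (i j : Fin 2) :
    (⟨partialD i (r j) u, partialD i (s j) u⟩ + ⟨r j u, s j u⟩ * A i + ⟨t j u, o j u⟩ * C i : ℂ)
      = ⟨partialD j (r i) u, partialD j (s i) u⟩ + ⟨r i u, s i u⟩ * A j + ⟨t i u, o i u⟩ * C j ∧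
    (⟨partialD i (t j) u, partialD i (o j) u⟩ + ⟨r j u, s j u⟩ * B i + ⟨t j u, o j u⟩ * D i : ℂ)
      = ⟨partialD j (t i) u, partialD j (o i) u⟩ + ⟨r i u, s i u⟩ * B j + ⟨t i u, o i u⟩ * D j := by
  have key : ∀ i j, partialD i (partialD j F) u =
      (⟨partialD i (r j) u, partialD i (s j) u⟩ + ⟨r j u, s j u⟩ * A i
        + ⟨t j u, o j u⟩ * C i : ℂ) • a u
      + (⟨partialD i (t j) u, partialD i (o j) u⟩ + ⟨r j u, s j u⟩ * B i
        + ⟨t j u, o j u⟩ * D i : ℂ) • b u := by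
    intro i j
    have e : partialD j F =ᶠ[𝓝 u] fun v =>
      (⟨r j v, s j v⟩ : ℂ) • a v + (⟨t j v, o j v⟩ : ℂ) • b v := hdF.mono fun v hv => hv j
    have h1 := differentiableAt_of_smooth (contDiffAt_complexMk (hr j) (hs j))
    have h2 := differentiableAt_of_smooth (contDiffAt_complexMk (ht j) (ho j))
    rw [partialD_congr e, partialD_add (h1.fun_smul ha) (h2.fun_smul hb), partialD_smul h1 ha,
      partialD_smul h2 hb, partialD_complexMk (differentiableAt_of_smooth (hr j))
      (differentiableAt_of_smooth (hs j)), partialD_complexMk (differentiableAt_of_smooth (ht j))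
      (differentiableAt_of_smooth (ho j)), hda, hdb]
    module
  have := partialD_comm (i := i) (j := j) hF
  rw [key, key] at this
  exact hab.coeff_eq this

/-- In the plane, `x ∧ p = c q ∧ p` means that `x - c q` is a multiple of `p`. -/
lemma eq_add_of_wedge {p q x : Fin 2 → ℝ} {c : ℝ} (hd : p 0 * q 1 - p 1 * q 0 ≠ 0)
    (hx : x 0 * p 1 - x 1 * p 0 = c * (q 0 * p 1 - q 1 * p 0)) (i : Fin 2) :
    x i = p i * ((x 0 * q 1 - x 1 * q 0) / (p 0 * q 1 - p 1 * q 0)) + q i * c := by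
  have ha := div_mul_cancel₀ (x 0 * q 1 - x 1 * q 0) hd
  revert i
  refine Fin.forall_fin_two.2 ⟨?_, ?_⟩ <;> apply mul_left_cancel₀ hd
  · linear_combination -(p 0) * ha - q 0 * hx
  · linear_combination -(p 1) * ha - q 1 * hx

lemma exists_coeff_of_wedge {p q x : Fin 2 → ℝ} {c : ℝ} (hd : p 0 * q 1 - p 1 * q 0 ≠ 0)
    (hx : x 0 * p 1 - x 1 * p 0 = c * (q 0 * p 1 - q 1 * p 0)) :
    ∃ a, ∀ i, x i = p i * a + q i * c :=
  ⟨_, eq_add_of_wedge hd hx⟩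

/-- A frame of null tangent fields `e₁`, `e₂` along the immersion `f` of the open set `U`, adapted
to a marginally trapped Lagrangian surface in that the mean curvature vector is `-i e₁`.
The forms `p`, `q` are the dual coframe, `w q` is the connection form of the induced metric, and
`lam`, `m` are the remaining coefficients of the second fundamental form:
`h(e₁, e₁) = lam i e₂`, `h(e₁, e₂) = i e₁`, `h(e₂, e₂) = m i e₁ + i e₂`. -/
structure IsAdaptedFrameOn (U : Set Plane) (f e₁ e₂ : Plane → C21) (p q : Fin 2 → Plane → ℝ)
    (w lam m : Plane → ℝ) : Prop where
  isOpen : IsOpen U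
  smooth_f : ∀ v ∈ U, ContDiffAt ℝ ∞ f v
  smooth_fst : ∀ v ∈ U, ContDiffAt ℝ ∞ e₁ v
  smooth_snd : ∀ v ∈ U, ContDiffAt ℝ ∞ e₂ v
  smooth_p : ∀ i, ∀ v ∈ U, ContDiffAt ℝ ∞ (p i) v
  smooth_q : ∀ i, ∀ v ∈ U, ContDiffAt ℝ ∞ (q i) v
  smooth_w : ∀ v ∈ U, ContDiffAt ℝ ∞ w v
  smooth_lam : ∀ v ∈ U, ContDiffAt ℝ ∞ lam v
  smooth_m : ∀ v ∈ U, ContDiffAt ℝ ∞ m v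
  nullPair : ∀ v ∈ U, IsNullPair (e₁ v) (e₂ v)
  det_ne_zero : ∀ v ∈ U, p 0 v * q 1 v - p 1 v * q 0 v ≠ 0
  deriv_f : ∀ v ∈ U, ∀ i, partialD i f v = p i v • e₁ v + q i v • e₂ v
  deriv_fst : ∀ v ∈ U, ∀ i, partialD i e₁ v =
    (⟨w v * q i v, q i v⟩ : ℂ) • e₁ v + (⟨0, lam v * p i v⟩ : ℂ) • e₂ v
  deriv_snd : ∀ v ∈ U, ∀ i, partialD i e₂ v =
    (⟨0, p i v + m v * q i v⟩ : ℂ) • e₁ v + (⟨-(w v * q i v), q i v⟩ : ℂ) • e₂ v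

namespace IsAdaptedFrameOn

variable {U : Set Plane} {f e₁ e₂ : Plane → C21} {p q : Fin 2 → Plane → ℝ}
    {w lam m : Plane → ℝ} (h : IsAdaptedFrameOn U f e₁ e₂ p q w lam m) {u : Plane} (hu : u ∈ U)
include h hu

lemma eventually_mem : ∀ᶠ v in 𝓝 u, v ∈ U := h.isOpen.mem_nhds hu

/-- Torsion freeness; `q` is closed because the connection form is a multiple of `q`. -/
lemma mixed_partials_f (i j : Fin 2) :
    partialD i (p j) u - partialD j (p i) u = -(w u * q i u * p j u - w u * q j u * p i u) ∧
    partialD i (q j) u - partialD j (q i) u = 0 := by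
  have key := mixed_partials_in_frame (s := fun _ _ => 0) (o := fun _ _ => 0) (h.smooth_f u hu)
    (h.nullPair u hu) (differentiableAt_of_smooth (h.smooth_fst u hu))
    (differentiableAt_of_smooth (h.smooth_snd u hu)) (fun i => h.smooth_p i u hu)
    (fun i => contDiffAt_const) (fun i => h.smooth_q i u hu) (fun i => contDiffAt_const)
    ((h.eventually_mem hu).mono fun v hv i => by
      rw [h.deriv_f v hv i]; congr 1)
    (h.deriv_fst u hu) (h.deriv_snd u hu) i j
  have h1 := congrArg Complex.re key.1
  have h2 := congrArg Complex.re key.2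
  simp at h1 h2
  constructor
  · linear_combination h1
  · linear_combination h2

/-- The equation of Gauss, and the equation of Codazzi for `h(e₁, e₁)`. -/
lemma mixed_partials_fst (i j : Fin 2) :
    (partialD i w u * q j u - partialD j w u * q i u =
      lam u * m u * (q i u * p j u - q j u * p i u)) ∧
    (partialD i lam u * p j u - partialD j lam u * p i u =
      3 * lam u * w u * (q i u * p j u - q j u * p i u)) := by
  have hw := h.smooth_w u hu
  have hl := h.smooth_lam u hu
  have hp := fun i => h.smooth_p i u hu
  have hq := fun i => h.smooth_q i u hu
  have key := mixed_partials_in_frame (r := fun i v => w v * q i v) (t := fun _ _ => 0)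
    (o := fun i v => lam v * p i v) (h.smooth_fst u hu)
    (h.nullPair u hu) (differentiableAt_of_smooth (h.smooth_fst u hu))
    (differentiableAt_of_smooth (h.smooth_snd u hu)) (fun i => hw.mul (hq i))
    hq (fun i => contDiffAt_const) (fun i => hl.mul (hp i))
    ((h.eventually_mem hu).mono fun v hv i => h.deriv_fst v hv i)
    (h.deriv_fst u hu) (h.deriv_snd u hu) i j
  simp only [partialD_mul (differentiableAt_of_smooth hw) (differentiableAt_of_smooth (hq _)),
    partialD_mul (differentiableAt_of_smooth hl) (differentiableAt_of_smooth (hp _))] at key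
  have h1 := congrArg Complex.re key.1
  have h2 := congrArg Complex.im key.2
  simp at h1 h2
  obtain ⟨h3, h4⟩ := h.mixed_partials_f hu i j
  constructor
  · linear_combination h1 - w u * h4
  · linear_combination h2 - lam u * h3

/-- The equation of Codazzi for `h(e₂, e₂)`. -/
lemma mixed_partials_snd (i j : Fin 2) :
    partialD i m u * q j u - partialD j m u * q i u = -w u * (q i u * p j u - q j u * p i u) := by
  have hw := h.smooth_w u hu
  have hm := h.smooth_m u hu
  have hp := fun i => h.smooth_p i u hu
  have hq := fun i => h.smooth_q i u hu
  have key := mixed_partials_in_frame (r := fun _ _ => 0) (s := fun i v => p i v + m v * q i v)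
    (t := fun i v => -(w v * q i v)) (h.smooth_snd u hu)
    (h.nullPair u hu) (differentiableAt_of_smooth (h.smooth_fst u hu))
    (differentiableAt_of_smooth (h.smooth_snd u hu)) (fun i => contDiffAt_const)
    (fun i => (hp i).add (hm.mul (hq i))) (fun i => (hw.mul (hq i)).neg) hq
    ((h.eventually_mem hu).mono fun v hv i => h.deriv_snd v hv i)
    (h.deriv_fst u hu) (h.deriv_snd u hu) i j
  have e : ∀ i j, partialD i (fun v => p j v + m v * q j v) u = partialD i (p j) u +
      (m u * partialD i (q j) u + partialD i m u * q j u) := fun i j => by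
    rw [partialD_add (differentiableAt_of_smooth (hp j))
      (differentiableAt_of_smooth (hm.mul (hq j))),
      partialD_mul (differentiableAt_of_smooth hm) (differentiableAt_of_smooth (hq j))]
  simp only [e] at key
  have h1 := congrArg Complex.im key.1
  simp at h1
  obtain ⟨h3, h4⟩ := h.mixed_partials_f hu i j
  linear_combination h1 - h3 - m u * h4

lemma isNullCoframeAt : IsNullCoframeAt f p q (fun i => w u * q i u) u where
  metric_eq := (h.eventually_mem hu).mono fun v hv i j =>
    metric_eq_of_isNullPair (h.deriv_f v hv) (h.nullPair v hv) i j
  diff_left i := differentiableAt_of_smooth (h.smooth_p i u hu)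
  diff_right i := differentiableAt_of_smooth (h.smooth_q i u hu)
  structure_left i j := (h.mixed_partials_f hu i j).1
  structure_right i j := by rw [(h.mixed_partials_f hu i j).2]; ring
  det_ne_zero := h.det_ne_zero u hu

lemma tension_eq : tension f u = (⟨0, -2⟩ : ℂ) • e₁ u := by
  rw [tension, (h.isNullCoframeAt hu).roughLaplacian_eq
    (A := (⟨0, lam u⟩ : ℂ) • e₂ u) (B := (⟨0, 1⟩ : ℂ) • e₁ u)
    (C := (⟨0, 1⟩ : ℂ) • e₁ u) (D := (⟨0, m u⟩ : ℂ) • e₁ u + (⟨0, 1⟩ : ℂ) • e₂ u)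
    ((h.eventually_mem hu).mono h.deriv_f) (differentiableAt_of_smooth (h.smooth_fst u hu))
    (differentiableAt_of_smooth (h.smooth_snd u hu))]
  · match_scalars
    apply Complex.ext <;> norm_num
  · intro i
    rw [h.deriv_fst u hu]
    match_scalars <;> apply Complex.ext <;> simp <;> ring
  · intro i
    rw [h.deriv_snd u hu]
    match_scalars <;> apply Complex.ext <;> simp <;> ring

lemma meanCurvature_eq : meanCurvature f u = (⟨0, -1⟩ : ℂ) • e₁ u := by
  have h1 := h.tension_eq hu
  rw [LorentzSurface.tension_eq] at h1
  calc meanCurvature f u = (1 / 2 : ℝ) • (2 : ℝ) • meanCurvature f u := by simp [smul_smul]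
    _ = _ := by
      rw [h1]
      match_scalars
      apply Complex.ext <;> norm_num

lemma partialD_tension (i : Fin 2) : partialD i (tension f) u =
    p i u • ((2 * lam u) • e₂ u) + q i u • ((⟨2, -2 * w u⟩ : ℂ) • e₁ u) := by
  have e : tension f =ᶠ[𝓝 u] fun v => (⟨0, -2⟩ : ℂ) • e₁ v :=
    (h.eventually_mem hu).mono fun v hv => h.tension_eq hv
  rw [partialD_congr e, partialD_const_smul _ (differentiableAt_of_smooth (h.smooth_fst u hu)),
    h.deriv_fst u hu]
  match_scalars <;> apply Complex.ext <;> simp <;> ring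

/-- Writing `τ(f) = -2 i e₁`, the second derivatives of the frame bring in `dλ` and `dw`, of which
only the components fixed by the equations of Gauss and Codazzi enter the trace. -/
lemma bitension_eq : bitension f u =
    (⟨0, -4 * lam u * m u⟩ : ℂ) • e₁ u + (⟨-4 * lam u * w u, -4 * lam u⟩ : ℂ) • e₂ u := by
  have hw := differentiableAt_of_smooth (h.smooth_w u hu)
  have hl := differentiableAt_of_smooth (h.smooth_lam u hu)
  have h1 := differentiableAt_of_smooth (h.smooth_fst u hu)
  have h2 := differentiableAt_of_smooth (h.smooth_snd u hu)
  have hd := h.det_ne_zero u hu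
  obtain ⟨hw1, hl2⟩ := h.mixed_partials_fst hu 0 1
  obtain ⟨L, hL⟩ := exists_coeff_of_wedge (p := (p · u)) (q := (q · u))
    (x := fun i => partialD i lam u) (c := 3 * lam u * w u) hd hl2
  obtain ⟨W, hW⟩ := exists_coeff_of_wedge (p := (q · u)) (q := (p · u))
    (x := fun i => partialD i w u) (c := -lam u * m u)
    (by contrapose! hd; linear_combination -hd) (by linear_combination hw1)
  have hF₁ : DifferentiableAt ℝ (fun v => (2 * lam v) • e₂ v) u :=
    (hl.const_mul 2).fun_smul h2
  have hc : ContDiffAt ℝ ∞ (fun v => -2 * w v) u := contDiffAt_const.mul (h.smooth_w u hu)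
  have hc' := differentiableAt_of_smooth
    (contDiffAt_complexMk (r := fun _ => (2 : ℝ)) contDiffAt_const hc)
  have hF₂ : DifferentiableAt ℝ (fun v => (⟨2, -2 * w v⟩ : ℂ) • e₁ v) u := hc'.fun_smul h1
  have dl : ∀ i, partialD i (fun v => 2 * lam v) u = 2 * (p i u * L + q i u * (3 * lam u * w u)) :=
    fun i => by rw [← hL]; exact partialD_const_smul (2 : ℝ) hl
  have dw : ∀ i, partialD i (fun v => -2 * w v) u = -2 * (q i u * W + p i u * (-lam u * m u)) :=
    fun i => by rw [← hW]; exact partialD_const_smul (-2 : ℝ) hw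
  rw [bitension, (h.isNullCoframeAt hu).roughLaplacian_eq
    (A := (⟨0, 2 * lam u⟩ : ℂ) • e₁ u + (2 * L) • e₂ u)
    (B := (⟨0, 2 * lam u * m u⟩ : ℂ) • e₁ u + (⟨2 * lam u * w u, 2 * lam u⟩ : ℂ) • e₂ u)
    (C := (⟨0, 2 * lam u * m u⟩ : ℂ) • e₁ u + (⟨2 * lam u * w u, 2 * lam u⟩ : ℂ) • e₂ u)
    (D := ((⟨0, -2 * W⟩ : ℂ) + ⟨2, -2 * w u⟩ * ⟨2 * w u, 1⟩) • e₁ u)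
    ((h.eventually_mem hu).mono fun v hv => h.partialD_tension hv) hF₁ hF₂]
  · match_scalars <;> apply Complex.ext <;> simp <;> ring
  · intro i
    rw [partialD_smul (hl.const_mul 2) h2, dl, h.deriv_snd u hu]
    match_scalars <;> apply Complex.ext <;> simp <;> ring
  · intro i
    rw [partialD_smul hc' h1, partialD_complexMk (differentiableAt_const _)
      (differentiableAt_of_smooth hc), dw, partialD_const, h.deriv_fst u hu]
    match_scalars <;> apply Complex.ext <;> simp <;> ring

/-- The square of the bitension field is `-32 λ² m`. -/
lemma lightlike_bitension_iff : Lightlike (bitension f u) ↔ lam u ≠ 0 ∧ m u = 0 := by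
  have hn := h.nullPair u hu
  rw [Lightlike, h.bitension_eq hu, lorentz_eq_re_herm, hn.herm_comb_self]
  have e : (-((⟨0, -4 * lam u * m u⟩ : ℂ) *
      (starRingEnd ℂ) ⟨-4 * lam u * w u, -4 * lam u⟩) - (starRingEnd ℂ) ⟨0, -4 * lam u * m u⟩ *
      ⟨-4 * lam u * w u, -4 * lam u⟩).re = -32 * lam u ^ 2 * m u := by
    simp; ring
  rw [e]
  constructor
  · rintro ⟨h1, h2⟩
    have hl : lam u ≠ 0 := by
      rintro hl
      apply h1
      rw [hl]
      simp [show (⟨0, 0⟩ : ℂ) = 0 from rfl]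
    refine ⟨hl, ?_⟩
    simpa [hl] using h2
  · rintro ⟨hl, hm⟩
    refine ⟨fun h0 => hl ?_, by simp [hm]⟩
    have h1 := hn.herm_comb_left (⟨0, -4 * lam u * m u⟩ : ℂ) ⟨-4 * lam u * w u, -4 * lam u⟩
    rw [h0, herm_zero_left] at h1
    simpa using congrArg Complex.im h1

lemma lightlike_meanCurvature : Lightlike (meanCurvature f u) := by
  have hn := h.nullPair u hu
  rw [h.meanCurvature_eq hu]
  refine ⟨smul_ne_zero (fun h0 => ?_) hn.left_ne_zero, ?_⟩
  · simpa using congrArg Complex.im h0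
  · rw [lorentz_self_eq_zero_iff, herm_smul_left, herm_smul_right, hn.left_null]; simp

end IsAdaptedFrameOn

/-! ### From a tangent null frame to an adapted frame -/

/-- Minus the real part of the connection coefficients `⟨∂ᵢ a, b⟩` of two vector fields along a
surface. -/
def frameRe (a b : Plane → C21) (i : Fin 2) (v : Plane) : ℝ := -(herm (partialD i a v) (b v)).re

/-- Minus the imaginary part of the connection coefficients `⟨∂ᵢ a, b⟩` of two vector fields along
a surface. -/
def frameIm (a b : Plane → C21) (i : Fin 2) (v : Plane) : ℝ := -(herm (partialD i a v) (b v)).im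

lemma contDiffAt_frameRe {a b : Plane → C21} {v : Plane} (ha : ContDiffAt ℝ ∞ a v)
    (hb : ContDiffAt ℝ ∞ b v) (i : Fin 2) : ContDiffAt ℝ ∞ (frameRe a b i) v :=
  (Complex.reCLM.contDiff.contDiffAt.comp v (contDiffAt_herm (contDiffAt_partialD ha) hb)).neg

lemma contDiffAt_frameIm {a b : Plane → C21} {v : Plane} (ha : ContDiffAt ℝ ∞ a v)
    (hb : ContDiffAt ℝ ∞ b v) (i : Fin 2) : ContDiffAt ℝ ∞ (frameIm a b i) v :=
  (Complex.imCLM.contDiff.contDiffAt.comp v (contDiffAt_herm (contDiffAt_partialD ha) hb)).neg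

/-- A frame of null tangent fields along `f`, with dual coframe `p`, `q`, whose first member is
`i` times the mean curvature vector field. -/
structure IsMeanCurvatureFrameOn (U : Set Plane) (f e₁ e₂ : Plane → C21)
    (p q : Fin 2 → Plane → ℝ) : Prop where
  isOpen : IsOpen U
  smooth_f : ∀ v ∈ U, ContDiffAt ℝ ∞ f v
  smooth_fst : ∀ v ∈ U, ContDiffAt ℝ ∞ e₁ v
  smooth_snd : ∀ v ∈ U, ContDiffAt ℝ ∞ e₂ v
  smooth_p : ∀ i, ∀ v ∈ U, ContDiffAt ℝ ∞ (p i) v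
  smooth_q : ∀ i, ∀ v ∈ U, ContDiffAt ℝ ∞ (q i) v
  nullPair : ∀ v ∈ U, IsNullPair (e₁ v) (e₂ v)
  det_ne_zero : ∀ v ∈ U, p 0 v * q 1 v - p 1 v * q 0 v ≠ 0
  deriv_f : ∀ v ∈ U, ∀ i, partialD i f v = p i v • e₁ v + q i v • e₂ v
  fst_eq : ∀ v ∈ U, e₁ v = Complex.I • meanCurvature f v

namespace IsMeanCurvatureFrameOn

variable {U : Set Plane} {f e₁ e₂ : Plane → C21} {p q : Fin 2 → Plane → ℝ}
  (h : IsMeanCurvatureFrameOn U f e₁ e₂ p q) {u : Plane} (hu : u ∈ U)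
include h hu

lemma eventually_mem : ∀ᶠ v in 𝓝 u, v ∈ U := h.isOpen.mem_nhds hu

/-- Differentiating the relations of a null pair. -/
lemma herm_partialD (i : Fin 2) :
    (herm (partialD i e₁ u) (e₁ u)).re = 0 ∧ (herm (partialD i e₂ u) (e₂ u)).re = 0 ∧
    (herm (partialD i e₂ u) (e₁ u)).re = -(herm (partialD i e₁ u) (e₂ u)).re ∧
    (herm (partialD i e₂ u) (e₁ u)).im = (herm (partialD i e₁ u) (e₂ u)).im := by
  have d₁ := differentiableAt_of_smooth (h.smooth_fst u hu)
  have d₂ := differentiableAt_of_smooth (h.smooth_snd u hu)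
  have k11 := partialD_herm (i := i) d₁ d₁
  have k22 := partialD_herm (i := i) d₂ d₂
  have k12 := partialD_herm (i := i) d₁ d₂
  have c11 : (fun v => herm (e₁ v) (e₁ v)) =ᶠ[𝓝 u] fun _ => 0 :=
    (h.eventually_mem hu).mono fun v hv => (h.nullPair v hv).left_null
  have c22 : (fun v => herm (e₂ v) (e₂ v)) =ᶠ[𝓝 u] fun _ => 0 :=
    (h.eventually_mem hu).mono fun v hv => (h.nullPair v hv).right_null
  have c12 : (fun v => herm (e₁ v) (e₂ v)) =ᶠ[𝓝 u] fun _ => -1 :=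
    (h.eventually_mem hu).mono fun v hv => (h.nullPair v hv).pairing
  rw [partialD_congr c11, partialD_const, ← herm_conj (partialD i e₁ u) (e₁ u)] at k11
  rw [partialD_congr c22, partialD_const, ← herm_conj (partialD i e₂ u) (e₂ u)] at k22
  rw [partialD_congr c12, partialD_const, ← herm_conj (partialD i e₂ u) (e₁ u)] at k12
  have r11 := congrArg Complex.re k11
  have r22 := congrArg Complex.re k22
  have r12 := congrArg Complex.re k12
  have i12 := congrArg Complex.im k12
  simp at r11 r22 r12 i12
  refine ⟨?_, ?_, ?_, ?_⟩ <;> linarith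

/-- The derivatives of the frame before the mean curvature is taken into account. -/
lemma deriv_fst_raw (i : Fin 2) : partialD i e₁ u =
    (⟨frameRe e₁ e₂ i u, frameIm e₁ e₂ i u⟩ : ℂ) • e₁ u
      + (⟨0, frameIm e₁ e₁ i u⟩ : ℂ) • e₂ u := by
  conv_lhs => rw [(h.nullPair u hu).decomp (partialD i e₁ u)]
  obtain ⟨h1, -⟩ := h.herm_partialD hu i
  congr 2
  apply Complex.ext <;> simp [frameIm, h1]

lemma deriv_snd_raw (i : Fin 2) : partialD i e₂ u =
    (⟨0, frameIm e₂ e₂ i u⟩ : ℂ) • e₁ u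
      + (⟨-frameRe e₁ e₂ i u, frameIm e₁ e₂ i u⟩ : ℂ) • e₂ u := by
  conv_lhs => rw [(h.nullPair u hu).decomp (partialD i e₂ u)]
  obtain ⟨-, h1, h2, h3⟩ := h.herm_partialD hu i
  congr 2 <;> apply Complex.ext <;> simp [frameIm, frameRe, h1, h2, h3]

/-- The real parts say that the connection is torsion free, the imaginary parts that the second
fundamental form is symmetric. -/
lemma mixed_partials_f (i j : Fin 2) :
    (partialD i (p j) u - partialD j (p i) u =
      -(frameRe e₁ e₂ i u * p j u - frameRe e₁ e₂ j u * p i u) ∧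
    partialD i (q j) u - partialD j (q i) u =
      frameRe e₁ e₂ i u * q j u - frameRe e₁ e₂ j u * q i u) ∧
    (frameIm e₁ e₂ i u * p j u - frameIm e₁ e₂ j u * p i u =
      -(frameIm e₂ e₂ i u * q j u - frameIm e₂ e₂ j u * q i u) ∧
    frameIm e₁ e₁ i u * p j u - frameIm e₁ e₁ j u * p i u =
      -(frameIm e₁ e₂ i u * q j u - frameIm e₁ e₂ j u * q i u)) := by
  have key := mixed_partials_in_frame (s := fun _ _ => 0) (o := fun _ _ => 0) (h.smooth_f u hu)
    (h.nullPair u hu) (differentiableAt_of_smooth (h.smooth_fst u hu))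
    (differentiableAt_of_smooth (h.smooth_snd u hu)) (fun i => h.smooth_p i u hu)
    (fun i => contDiffAt_const) (fun i => h.smooth_q i u hu) (fun i => contDiffAt_const)
    ((h.eventually_mem hu).mono fun v hv i => by
      rw [h.deriv_f v hv i]; congr 1)
    (h.deriv_fst_raw hu) (h.deriv_snd_raw hu) i j
  have h1 := congrArg Complex.re key.1
  have h2 := congrArg Complex.re key.2
  have h3 := congrArg Complex.im key.1
  have h4 := congrArg Complex.im key.2
  simp [partialD_const] at h1 h2 h3 h4
  refine ⟨⟨?_, ?_⟩, ?_, ?_⟩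
  · linear_combination h1
  · linear_combination h2
  · linear_combination h3
  · linear_combination h4

lemma isNullCoframeAt : IsNullCoframeAt f p q (fun i => frameRe e₁ e₂ i u) u where
  metric_eq := (h.eventually_mem hu).mono fun v hv i j =>
    metric_eq_of_isNullPair (h.deriv_f v hv) (h.nullPair v hv) i j
  diff_left i := differentiableAt_of_smooth (h.smooth_p i u hu)
  diff_right i := differentiableAt_of_smooth (h.smooth_q i u hu)
  structure_left i j := (h.mixed_partials_f hu i j).1.1
  structure_right i j := (h.mixed_partials_f hu i j).1.2
  det_ne_zero := h.det_ne_zero u hu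

/-- Reading off the mean curvature vector in the frame determines the coefficients of the second
fundamental form, except for two. -/
lemma frameIm_eq : (∀ i, frameIm e₁ e₂ i u = q i u) ∧
    frameIm e₁ e₁ 0 u * p 1 u - frameIm e₁ e₁ 1 u * p 0 u = 0 ∧
    frameIm e₂ e₂ 0 u * q 1 u - frameIm e₂ e₂ 1 u * q 0 u = p 0 u * q 1 u - p 1 u * q 0 u := by
  have hd := h.det_ne_zero u hu
  obtain ⟨-, hpa, hpb⟩ := h.mixed_partials_f hu 0 1
  set α := fun i => frameIm e₁ e₂ i u with hα
  set β := fun i => frameIm e₁ e₁ i u with hβ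
  set γ := fun i => frameIm e₂ e₂ i u with hγ
  -- components of the three forms with respect to the coframe
  obtain ⟨Δ, hΔ⟩ : ∃ Δ, Δ = p 0 u * q 1 u - p 1 u * q 0 u := ⟨_, rfl⟩
  have comp : ∀ x : Fin 2 → ℝ, ∃ a b, (∀ i, x i = p i u * a + q i u * b) ∧
      x 0 * q 1 u - x 1 * q 0 u = a * Δ ∧ x 0 * p 1 u - x 1 * p 0 u = -(b * Δ) := by
    intro x
    rw [← hΔ] at hd
    refine ⟨(x 0 * q 1 u - x 1 * q 0 u) / Δ, -(x 0 * p 1 u - x 1 * p 0 u) / Δ, ?_, ?_, ?_⟩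
    · have := eq_add_of_wedge (p := (p · u)) (q := (q · u)) (x := x)
        (c := -(x 0 * p 1 u - x 1 * p 0 u) / Δ) (by rw [← hΔ]; exact hd)
        (by field_simp; rw [hΔ]; ring)
      rw [← hΔ] at this
      exact this
    · field_simp
    · field_simp
  obtain ⟨α₁, α₂, ha, ha1, ha2⟩ := comp α
  obtain ⟨β₁, β₂, hb, hb1, hb2⟩ := comp β
  obtain ⟨γ₁, γ₂, hc, hc1, hc2⟩ := comp γ
  have hγα : γ₁ = α₂ := by
    apply mul_right_cancel₀ (hΔ ▸ hd : Δ ≠ 0)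
    linear_combination -hc1 - ha2 + hpa
  have hβα : β₂ = α₁ := by
    apply mul_right_cancel₀ (hΔ ▸ hd : Δ ≠ 0)
    linear_combination ha1 + hb2 - hpb
  have ht : tension f u = _ := (h.isNullCoframeAt hu).roughLaplacian_eq
    (A := (⟨0, α₁⟩ : ℂ) • e₁ u + (⟨0, β₁⟩ : ℂ) • e₂ u)
    (B := (⟨0, α₂⟩ : ℂ) • e₁ u + (⟨0, β₂⟩ : ℂ) • e₂ u)
    (C := (⟨0, γ₁⟩ : ℂ) • e₁ u + (⟨0, α₁⟩ : ℂ) • e₂ u)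
    (D := (⟨0, γ₂⟩ : ℂ) • e₁ u + (⟨0, α₂⟩ : ℂ) • e₂ u)
    ((h.eventually_mem hu).mono h.deriv_f) (differentiableAt_of_smooth (h.smooth_fst u hu))
    (differentiableAt_of_smooth (h.smooth_snd u hu))
    (fun i => by
      rw [h.deriv_fst_raw hu]
      have e1 : frameIm e₁ e₂ i u = _ := ha i
      have e2 : frameIm e₁ e₁ i u = _ := hb i
      rw [e1, e2]
      match_scalars <;> apply Complex.ext <;> simp)
    (fun i => by
      rw [h.deriv_snd_raw hu]
      have e1 : frameIm e₁ e₂ i u = _ := ha i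
      have e2 : frameIm e₂ e₂ i u = _ := hc i
      rw [e1, e2]
      match_scalars <;> apply Complex.ext <;> simp)
  have hH : meanCurvature f u = (-Complex.I) • e₁ u := by
    rw [h.fst_eq u hu, smul_smul]; simp
  have e : (⟨0, -2⟩ : ℂ) • e₁ u + (0 : ℂ) • e₂ u =
      (⟨0, -2 * α₂⟩ : ℂ) • e₁ u + (⟨0, -2 * α₁⟩ : ℂ) • e₂ u := by
    rw [tension_eq, hH, hγα, hβα] at ht
    calc _ = (2 : ℝ) • -Complex.I • e₁ u := by
          match_scalars <;> apply Complex.ext <;> simp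
      _ = _ := ht
      _ = _ := by match_scalars <;> apply Complex.ext <;> simp <;> ring
  obtain ⟨e1, e2⟩ := (h.nullPair u hu).coeff_eq e
  have e1 := congrArg Complex.im e1
  have e2 := congrArg Complex.im e2
  simp at e1 e2
  have hα₂ : α₂ = 1 := by linarith
  refine ⟨fun i => ?_, ?_, ?_⟩
  · have := ha i
    rw [e2, hα₂] at this
    simpa using this
  · rw [hβα, e2] at hb2
    simpa using hb2
  · rw [hγα, hα₂, hΔ] at hc1
    simpa using hc1

/-- The connection form is a multiple of `q`. -/
lemma frameRe_wedge : frameRe e₁ e₂ 0 u * q 1 u - frameRe e₁ e₂ 1 u * q 0 u = 0 := by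
  have hs : ∀ a b, (∀ v ∈ U, ContDiffAt ℝ ∞ a v) → (∀ v ∈ U, ContDiffAt ℝ ∞ b v) → ∀ i,
      ContDiffAt ℝ ∞ (frameRe a b i) u ∧ ContDiffAt ℝ ∞ (frameIm a b i) u := fun a b ha hb i =>
    ⟨contDiffAt_frameRe (ha u hu) (hb u hu) i, contDiffAt_frameIm (ha u hu) (hb u hu) i⟩
  have key := mixed_partials_in_frame (r := frameRe e₁ e₂) (s := q) (t := fun _ _ => 0)
    (o := frameIm e₁ e₁) (h.smooth_fst u hu)
    (h.nullPair u hu) (differentiableAt_of_smooth (h.smooth_fst u hu))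
    (differentiableAt_of_smooth (h.smooth_snd u hu))
    (fun i => (hs e₁ e₂ h.smooth_fst h.smooth_snd i).1) (fun i => h.smooth_q i u hu)
    (fun i => contDiffAt_const) (fun i => (hs e₁ e₁ h.smooth_fst h.smooth_fst i).2)
    ((h.eventually_mem hu).mono fun v hv i => by
      rw [h.deriv_fst_raw hv, (h.frameIm_eq hv).1])
    (h.deriv_fst_raw hu) (h.deriv_snd_raw hu) 0 1
  have h1 := congrArg Complex.im key.1
  simp [(h.frameIm_eq hu).1] at h1
  obtain ⟨⟨-, h2⟩, -⟩ := h.mixed_partials_f hu 0 1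
  linear_combination h1 - h2

end IsMeanCurvatureFrameOn

theorem IsMeanCurvatureFrameOn.exists_isAdaptedFrameOn {U : Set Plane} {f e₁ e₂ : Plane → C21}
    {p q : Fin 2 → Plane → ℝ} (h : IsMeanCurvatureFrameOn U f e₁ e₂ p q) :
    ∃ w lam m, IsAdaptedFrameOn U f e₁ e₂ p q w lam m := by
  have hd := h.det_ne_zero
  have hd' : ∀ v ∈ U, q 0 v * p 1 v - q 1 v * p 0 v ≠ 0 := fun v hv h0 =>
    hd v hv (by linear_combination -h0)
  refine ⟨fun v => (frameRe e₁ e₂ 0 v * p 1 v - frameRe e₁ e₂ 1 v * p 0 v) /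
      (q 0 v * p 1 v - q 1 v * p 0 v),
    fun v => (frameIm e₁ e₁ 0 v * q 1 v - frameIm e₁ e₁ 1 v * q 0 v) /
      (p 0 v * q 1 v - p 1 v * q 0 v),
    fun v => (frameIm e₂ e₂ 0 v * p 1 v - frameIm e₂ e₂ 1 v * p 0 v) /
      (q 0 v * p 1 v - q 1 v * p 0 v), ?_⟩
  have sp := h.smooth_p
  have sq := h.smooth_q
  have s₁ := h.smooth_fst
  have s₂ := h.smooth_snd
  have hw : ∀ v (hv : v ∈ U) i, frameRe e₁ e₂ i v =
      (frameRe e₁ e₂ 0 v * p 1 v - frameRe e₁ e₂ 1 v * p 0 v) /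
      (q 0 v * p 1 v - q 1 v * p 0 v) * q i v := fun v hv i => by
    have := eq_add_of_wedge (p := (q · v)) (q := (p · v)) (x := (frameRe e₁ e₂ · v)) (c := 0)
      (hd' v hv) (by rw [h.frameRe_wedge hv]; ring) i
    rw [mul_comm]
    simpa using this
  refine ⟨h.isOpen, h.smooth_f, s₁, s₂, sp, sq, fun v hv => ?_, fun v hv => ?_, fun v hv => ?_,
    h.nullPair, hd, h.deriv_f, fun v hv i => ?_, fun v hv i => ?_⟩
  · exact ((((contDiffAt_frameRe (s₁ v hv) (s₂ v hv) 0).mul (sp 1 v hv)).sub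
      ((contDiffAt_frameRe (s₁ v hv) (s₂ v hv) 1).mul (sp 0 v hv)))).div
      (((sq 0 v hv).mul (sp 1 v hv)).sub ((sq 1 v hv).mul (sp 0 v hv))) (hd' v hv)
  · exact ((((contDiffAt_frameIm (s₁ v hv) (s₁ v hv) 0).mul (sq 1 v hv)).sub
      ((contDiffAt_frameIm (s₁ v hv) (s₁ v hv) 1).mul (sq 0 v hv)))).div
      (((sp 0 v hv).mul (sq 1 v hv)).sub ((sp 1 v hv).mul (sq 0 v hv))) (hd v hv)
  · exact ((((contDiffAt_frameIm (s₂ v hv) (s₂ v hv) 0).mul (sp 1 v hv)).sub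
      ((contDiffAt_frameIm (s₂ v hv) (s₂ v hv) 1).mul (sp 0 v hv)))).div
      (((sq 0 v hv).mul (sp 1 v hv)).sub ((sq 1 v hv).mul (sp 0 v hv))) (hd' v hv)
  · have hb := eq_add_of_wedge (p := (p · v)) (q := (q · v)) (x := (frameIm e₁ e₁ · v)) (c := 0)
      (hd v hv) (by rw [(h.frameIm_eq hv).2.1]; ring) i
    rw [h.deriv_fst_raw hv, (h.frameIm_eq hv).1, ← hw v hv i, hb, mul_zero, add_zero, mul_comm]
  · have hc := eq_add_of_wedge (p := (q · v)) (q := (p · v)) (x := (frameIm e₂ e₂ · v)) (c := 1)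
      (hd' v hv) (by rw [(h.frameIm_eq hv).2.2]; ring) i
    rw [h.deriv_snd_raw hv, (h.frameIm_eq hv).1, ← hw v hv i, hc, mul_one, add_comm (p i v),
      mul_comm (q i v) _]

/-! ### The null frame of a marginally trapped Lagrangian surface -/

/-- A smooth Lagrangian immersion of the open set `U` with nondegenerate induced metric. -/
structure IsLagrangianImmersionOn (U : Set Plane) (f : Plane → C21) : Prop where
  isOpen : IsOpen U
  smooth : ∀ v ∈ U, ContDiffAt ℝ ∞ f v
  immersive : ∀ v ∈ U, Function.Injective (fderiv ℝ f v)
  nondegenerate : ∀ v ∈ U, ∀ x, (∀ y, lorentz (fderiv ℝ f v x) (fderiv ℝ f v y) = 0) →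
    fderiv ℝ f v x = 0
  lagrangian : ∀ v ∈ U, ∀ ξ, (∀ y, lorentz ξ (fderiv ℝ f v y) = 0) ↔
    ∃ x, ξ = Complex.I • fderiv ℝ f v x

namespace IsLagrangianImmersionOn

variable {U : Set Plane} {f : Plane → C21} (h : IsLagrangianImmersionOn U f) {u : Plane}
  (hu : u ∈ U)
include h hu

lemma eventually_mem : ∀ᶠ v in 𝓝 u, v ∈ U := h.isOpen.mem_nhds hu

lemma det_metric_ne_zero : (metric f u).det ≠ 0 := by
  intro h0
  obtain ⟨x, hx, hGx⟩ := Matrix.exists_mulVec_eq_zero_iff.2 h0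
  apply hx
  have hz : fderiv ℝ f u (WithLp.toLp 2 x) = 0 := by
    apply h.nondegenerate u hu
    intro y
    have g0 := congrFun hGx 0
    have g1 := congrFun hGx 1
    simp only [Matrix.mulVec, dotProduct, Fin.sum_univ_two, metric, Matrix.of_apply,
      Pi.zero_apply] at g0 g1
    rw [fderiv_eq_sum_partialD, fderiv_eq_sum_partialD]
    simp only [lorentz_add_left, lorentz_add_right, lorentz_smul_left, lorentz_smul_right]
    rw [lorentz_comm (partialD 1 f u) (partialD 0 f u)]
    rw [lorentz_comm (partialD 1 f u) (partialD 0 f u)] at g1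
    linear_combination y 0 * g0 + y 1 * g1
  have := h.immersive u hu (hz.trans (map_zero _).symm)
  ext i
  simpa using congrArg (fun z : Plane => z i) this

/-- Two tangent vectors of a Lagrangian plane have real Hermitian product. -/
lemma herm_fderiv (x y : Plane) : herm (fderiv ℝ f u x) (fderiv ℝ f u y) =
    (lorentz (fderiv ℝ f u x) (fderiv ℝ f u y) : ℝ) := by
  have := ((h.lagrangian u hu (Complex.I • fderiv ℝ f u x)).2 ⟨x, rfl⟩) y
  rw [lorentz_I_smul_left, neg_eq_zero] at this
  exact Complex.ext rfl this

lemma contDiffAt_metric (i j : Fin 2) : ContDiffAt ℝ ∞ (fun v => metric f v i j) u :=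
  contDiffAt_lorentz (contDiffAt_partialD (h.smooth u hu)) (contDiffAt_partialD (h.smooth u hu))

lemma contDiffAt_metric_inv (i j : Fin 2) :
    ContDiffAt ℝ ∞ (fun v => (metric f v)⁻¹ i j) u := by
  have hm := h.contDiffAt_metric hu
  have hdet : ContDiffAt ℝ ∞ (fun v => (metric f v).det) u := by
    simp only [Matrix.det_fin_two]
    exact ((hm 0 0).mul (hm 1 1)).sub ((hm 0 1).mul (hm 1 0))
  have hadj : ContDiffAt ℝ ∞ (fun v => (metric f v).adjugate i j) u := by
    simp only [Matrix.adjugate_fin_two]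
    fin_cases i <;> fin_cases j
    · exact hm 1 1
    · exact (hm 0 1).neg
    · exact (hm 1 0).neg
    · exact hm 0 0
  simp only [Matrix.inv_def, Matrix.smul_apply, Ring.inverse_eq_inv', smul_eq_mul]
  exact (hdet.inv (h.det_metric_ne_zero hu)).mul hadj

lemma contDiffAt_christoffel (k i j : Fin 2) : ContDiffAt ℝ ∞ (christoffel f k i j) u :=
  contDiffAt_const.mul (ContDiffAt.sum fun l _ => (h.contDiffAt_metric_inv hu k l).mul
    (((contDiffAt_partialD (h.contDiffAt_metric hu j l)).add
      (contDiffAt_partialD (h.contDiffAt_metric hu i l))).sub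
      (contDiffAt_partialD (h.contDiffAt_metric hu i j))))

lemma contDiffAt_meanCurvature : ContDiffAt ℝ ∞ (meanCurvature f) u := by
  have hs := h.smooth u hu
  have hc : ∀ i j, ContDiffAt ℝ ∞ (secondFundForm f i j) u := fun i j =>
    (contDiffAt_partialD (contDiffAt_partialD hs)).sub
      (ContDiffAt.sum fun k _ => (h.contDiffAt_christoffel hu k i j).smul
        (contDiffAt_partialD hs))
  have : ContDiffAt ℝ ∞ (fun v => ∑ i, ∑ j, (metric f v)⁻¹ i j • secondFundForm f i j v) u :=
    ContDiffAt.sum fun i _ => ContDiffAt.sum fun j _ =>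
      (h.contDiffAt_metric_inv hu i j).smul (hc i j)
  exact this.const_smul (1 / 2 : ℝ)

/-- The Koszul formula for the induced metric: the Christoffel symbols give the tangential part
of the second derivatives of the immersion. -/
lemma sum_christoffel_mul_metric (i j l : Fin 2) :
    ∑ k, christoffel f k i j u * metric f u k l =
      lorentz (partialD i (partialD j f) u) (partialD l f u) := by
  have hs := h.smooth u hu
  have hd := fun k => differentiableAt_of_smooth (contDiffAt_partialD (i := k) hs)
  have hg : ∀ k i j, partialD k (fun v => metric f v i j) u =
      lorentz (partialD k (partialD i f) u) (partialD j f u)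
      + lorentz (partialD i f u) (partialD k (partialD j f) u) := fun k i j =>
    partialD_lorentz (hd i) (hd j)
  have hsymm : ∀ k l, metric f u k l = metric f u l k := fun k l => lorentz_comm _ _
  have hinv : ∀ m, ∑ k, (metric f u) l k * (metric f u)⁻¹ k m = (1 : Matrix _ _ ℝ) l m := by
    intro m
    rw [← Matrix.mul_nonsing_inv (metric f u) (h.det_metric_ne_zero hu).isUnit, Matrix.mul_apply]
  set B := fun m => partialD i (fun v => metric f v j m) u + partialD j (fun v => metric f v i m) u
      - partialD m (fun v => metric f v i j) u with hB
  have hBl : (1 / 2) * B l = lorentz (partialD i (partialD j f) u) (partialD l f u) := by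
    simp only [hB, hg, partialD_comm (i := j) (j := i) hs, partialD_comm (i := l) (j := i) hs,
      partialD_comm (i := l) (j := j) hs, lorentz_comm (partialD i f u),
      lorentz_comm (partialD j f u)]
    ring
  calc ∑ k, christoffel f k i j u * metric f u k l
      = (1 / 2) * ∑ m, (∑ k, (metric f u) l k * (metric f u)⁻¹ k m) * B m := by
        simp only [christoffel, Fin.sum_univ_two, hB, hsymm _ l]
        ring
    _ = (1 / 2) * B l := by
        simp only [hinv, Matrix.one_apply, ite_mul, one_mul, zero_mul, Finset.sum_ite_eq,
          Finset.mem_univ, if_true]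
    _ = _ := hBl

lemma lorentz_secondFundForm (i j l : Fin 2) :
    lorentz (secondFundForm f i j u) (partialD l f u) = 0 := by
  rw [secondFundForm, secondCovDeriv, sub_eq_add_neg, lorentz_add_left,
    ← h.sum_christoffel_mul_metric hu, ← neg_one_smul ℝ (∑ k, _), lorentz_smul_left]
  simp only [Fin.sum_univ_two, lorentz_add_left, lorentz_smul_left, metric, Matrix.of_apply]
  ring

/-- The mean curvature vector is normal, hence, the surface being Lagrangian, `i` times a tangent
vector. -/
lemma exists_fderiv_eq_I_smul_meanCurvature :
    ∃ x, Complex.I • meanCurvature f u = fderiv ℝ f u x := by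
  obtain ⟨x, hx⟩ := (h.lagrangian u hu (meanCurvature f u)).1 fun y => by
    rw [fderiv_eq_sum_partialD]
    simp only [meanCurvature, Fin.sum_univ_two, lorentz_add_left, lorentz_smul_left,
      lorentz_add_right, lorentz_smul_right, h.lorentz_secondFundForm hu]
    ring
  refine ⟨-x, ?_⟩
  rw [hx, smul_smul, Complex.I_mul_I, map_neg, neg_one_smul]

end IsLagrangianImmersionOn

/-- Components of the identity `df = e₁ p + e₂ q` at a point where `e₁`, `e₂` are tangent. -/
lemma partialD_eq_of_isNullPair {f : Plane → C21} {v : Plane} {a b : C21} (hab : IsNullPair a b)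
    (i : Fin 2) (ha : herm (partialD i f v) a = (lorentz (partialD i f v) a : ℝ))
    (hb : herm (partialD i f v) b = (lorentz (partialD i f v) b : ℝ)) :
    partialD i f v = (-lorentz (partialD i f v) b) • a + (-lorentz (partialD i f v) a) • b := by
  conv_lhs => rw [hab.decomp (partialD i f v), ha, hb]
  congr 1
  · rw [← Complex.ofReal_neg]; rfl
  · rw [← Complex.ofReal_neg]; rfl

/-- The coframe dual to a frame of an immersion is nondegenerate. -/
lemma coframe_det_ne_zero {V : Type*} [NormedAddCommGroup V] [NormedSpace ℝ V] {f : Plane → V}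
    {v : Plane} {a b : V} {p q : Fin 2 → ℝ}
    (hinj : Function.Injective (fderiv ℝ f v))
    (hf : ∀ i, partialD i f v = p i • a + q i • b) : p 0 * q 1 - p 1 * q 0 ≠ 0 := by
  intro h0
  have key : ∀ c d : ℝ, c • partialD 0 f v + d • partialD 1 f v = 0 → c = 0 ∧ d = 0 := by
    intro c d hcd
    have hx : fderiv ℝ f v !₂[c, d] = 0 := by
      rw [fderiv_eq_sum_partialD]; simpa using hcd
    have := hinj (hx.trans (map_zero _).symm)
    exact ⟨by simpa using congrArg (fun z : Plane => z 0) this,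
      by simpa using congrArg (fun z : Plane => z 1) this⟩
  have hq := key (q 1) (-q 0) (by
    rw [hf, hf]
    have : q 1 • (p 0 • a + q 0 • b) + -q 0 • (p 1 • a + q 1 • b) =
      (p 0 * q 1 - p 1 * q 0) • a := by module
    rw [this, h0, zero_smul])
  have hp := key (p 1) (-p 0) (by
    rw [hf, hf]
    have : p 1 • (p 0 • a + q 0 • b) + -p 0 • (p 1 • a + q 1 • b) =
      (-(p 0 * q 1 - p 1 * q 0)) • b := by module
    rw [this, h0, neg_zero, zero_smul])
  have h1 := key 1 0 (by
    rw [hf 0, neg_eq_zero.1 hq.2, neg_eq_zero.1 hp.2]; simp)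
  exact one_ne_zero h1.1

theorem IsLagrangianImmersionOn.exists_isMeanCurvatureFrameOn {U : Set Plane} {f : Plane → C21}
    (h : IsLagrangianImmersionOn U f) (hH : ∀ v ∈ U, Lightlike (meanCurvature f v))
    {u : Plane} (hu : u ∈ U) :
    ∃ U' ⊆ U, u ∈ U' ∧ ∃ e₁ e₂ p q, IsMeanCurvatureFrameOn U' f e₁ e₂ p q := by
  set e₁ : Plane → C21 := fun v => Complex.I • meanCurvature f v with he₁
  have smooth₁ : ∀ v ∈ U, ContDiffAt ℝ ∞ e₁ v := fun v hv =>
    (h.contDiffAt_meanCurvature hv).const_smul Complex.I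
  have tangent₁ : ∀ v ∈ U, ∃ x, e₁ v = fderiv ℝ f v x := fun v hv =>
    h.exists_fderiv_eq_I_smul_meanCurvature hv
  have smoothℓ : ∀ k, ∀ v ∈ U, ContDiffAt ℝ ∞ (fun v => lorentz (e₁ v) (partialD k f v)) v :=
    fun k v hv => contDiffAt_lorentz (smooth₁ v hv) (contDiffAt_partialD (h.smooth v hv))
  -- nondegeneracy gives a coordinate field that pairs nontrivially with `e₁`
  obtain ⟨k, hk⟩ : ∃ k, lorentz (e₁ u) (partialD k f u) ≠ 0 := by
    by_contra! hno
    obtain ⟨x, hx⟩ := tangent₁ u hu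
    have h0 : e₁ u = 0 := by
      rw [hx]
      apply h.nondegenerate u hu
      intro y
      rw [← hx, fderiv_eq_sum_partialD, lorentz_add_right, lorentz_smul_right,
        lorentz_smul_right, hno, hno]
      simp
    exact smul_ne_zero Complex.I_ne_zero (hH u hu).1 h0
  set ℓ : Plane → ℝ := fun v => lorentz (e₁ v) (partialD k f v) with hℓ
  set e₂ : Plane → C21 := fun v => (-(ℓ v)⁻¹) • partialD k f v
    + ((ℓ v)⁻¹ ^ 2 * lorentz (partialD k f v) (partialD k f v) / 2) • e₁ v with he₂
  set U' := {v | v ∈ U ∧ ℓ v ≠ 0} with hU'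
  have hsub : U' ⊆ U := fun v hv => hv.1
  have hopen : IsOpen U' :=
    isOpen_iff_mem_nhds.2 fun v hv => (h.eventually_mem hv.1).and
      ((smoothℓ k v hv.1).continuousAt.eventually_ne hv.2)
  have smooth₂ : ∀ v ∈ U', ContDiffAt ℝ ∞ e₂ v := fun v hv => by
    have hs := contDiffAt_partialD (i := k) (h.smooth v hv.1)
    have hi := (smoothℓ k v hv.1).inv hv.2
    exact (hi.neg.smul hs).add ((((hi.pow 2).mul (contDiffAt_lorentz hs hs)).div_const 2).smul
      (smooth₁ v hv.1))
  have tangent₂ : ∀ v ∈ U', ∃ x, e₂ v = fderiv ℝ f v x := fun v hv => by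
    obtain ⟨x, hx⟩ := tangent₁ v hv.1
    refine ⟨(-(ℓ v)⁻¹) • EuclideanSpace.single k 1
      + ((ℓ v)⁻¹ ^ 2 * lorentz (partialD k f v) (partialD k f v) / 2) • x, ?_⟩
    rw [map_add, map_smul, map_smul, ← hx]
    rfl
  have null₁ : ∀ v ∈ U, lorentz (e₁ v) (e₁ v) = 0 := fun v hv => by
    rw [he₁, lorentz_I_smul_I_smul]; exact (hH v hv).2
  have pair : ∀ v ∈ U', IsNullPair (e₁ v) (e₂ v) := fun v hv => by
    obtain ⟨x, hx⟩ := tangent₁ v hv.1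
    obtain ⟨y, hy⟩ := tangent₂ v hv
    have h12 : lorentz (e₁ v) (e₂ v) = -1 := by
      simp only [he₂, lorentz_add_right, lorentz_smul_right, null₁ v hv.1]
      change -(ℓ v)⁻¹ * ℓ v + _ * 0 = -1
      rw [mul_zero, add_zero, neg_mul, inv_mul_cancel₀ hv.2]
    have h22 : lorentz (e₂ v) (e₂ v) = 0 := by
      simp only [he₂, lorentz_add_right, lorentz_smul_right, lorentz_add_left, lorentz_smul_left,
        null₁ v hv.1, lorentz_comm (partialD k f v) (e₁ v)]
      have hm := inv_mul_cancel₀ hv.2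
      have hl : lorentz (e₁ v) (partialD k f v) = ℓ v := rfl
      rw [hl]
      linear_combination -((ℓ v)⁻¹ ^ 2 * lorentz (partialD k f v) (partialD k f v)) * hm
    refine ⟨(lorentz_self_eq_zero_iff _).1 (null₁ v hv.1), (lorentz_self_eq_zero_iff _).1 h22, ?_⟩
    rw [hx, hy, h.herm_fderiv hv.1, ← hx, ← hy, h12]
    simp
  have deriv : ∀ v ∈ U', ∀ i, partialD i f v =
      (-lorentz (partialD i f v) (e₂ v)) • e₁ v + (-lorentz (partialD i f v) (e₁ v)) • e₂ v :=
    fun v hv i => by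
      obtain ⟨x, hx⟩ := tangent₁ v hv.1
      obtain ⟨y, hy⟩ := tangent₂ v hv
      refine partialD_eq_of_isNullPair (pair v hv) i ?_ ?_
      · rw [hx]; exact h.herm_fderiv hv.1 _ _
      · rw [hy]; exact h.herm_fderiv hv.1 _ _
  refine ⟨U', hsub, ⟨hu, hk⟩, e₁, e₂, fun i v => -lorentz (partialD i f v) (e₂ v),
    fun i v => -lorentz (partialD i f v) (e₁ v), hopen, fun v hv => h.smooth v hv.1,
    fun v hv => smooth₁ v hv.1, smooth₂, fun i v hv => ?_, fun i v hv => ?_, pair, fun v hv => ?_,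
    deriv, fun v _ => rfl⟩
  · exact (contDiffAt_lorentz (contDiffAt_partialD (h.smooth v hv.1)) (smooth₂ v hv)).neg
  · exact (contDiffAt_lorentz (contDiffAt_partialD (h.smooth v hv.1)) (smooth₁ v hv.1)).neg
  · exact coframe_det_ne_zero (h.immersive v hv.1) (deriv v hv)

/-! ### Coordinates with a prescribed closed coframe -/

/-- The Poincaré lemma for a `1`-form on a convex open subset of the plane, given by its
components. -/
lemma exists_potential {s : Set Plane} (hs : Convex ℝ s) (hso : IsOpen s) {p : Fin 2 → Plane → ℝ}
    (hp : ∀ i, ∀ v ∈ s, ContDiffAt ℝ ∞ (p i) v)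
    (hclosed : ∀ v ∈ s, ∀ i j, partialD i (p j) v = partialD j (p i) v) :
    ∃ X : Plane → ℝ, ∀ v ∈ s, ContDiffAt ℝ ∞ X v ∧
      ∀ y, fderiv ℝ X v y = p 0 v * y 0 + p 1 v * y 1 := by
  set P : Plane → Plane →L[ℝ] ℝ := fun v => p 0 v • EuclideanSpace.proj 0
    + p 1 v • EuclideanSpace.proj 1 with hP
  have hPs : ∀ v ∈ s, ContDiffAt ℝ ∞ P v := fun v hv =>
    ((hp 0 v hv).smul contDiffAt_const).add ((hp 1 v hv).smul contDiffAt_const)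
  have hPd : ∀ v ∈ s, ∀ x y, fderiv ℝ P v x y =
      fderiv ℝ (p 0) v x * y 0 + fderiv ℝ (p 1) v x * y 1 := by
    intro v hv x y
    have d0 := (differentiableAt_of_smooth (hp 0 v hv)).hasFDerivAt.smul_const
      (EuclideanSpace.proj 0 : Plane →L[ℝ] ℝ)
    have d1 := (differentiableAt_of_smooth (hp 1 v hv)).hasFDerivAt.smul_const
      (EuclideanSpace.proj 1 : Plane →L[ℝ] ℝ)
    have : HasFDerivAt P _ v := d0.add d1
    rw [this.fderiv]
    simp
  obtain ⟨X, hX⟩ := hs.exists_forall_hasFDerivAt_of_fderiv_symmetric hso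
    (fun v hv => (differentiableAt_of_smooth (hPs v hv)).differentiableWithinAt)
    (fun v hv x y => by
      rw [hPd v hv, hPd v hv]
      simp only [fderiv_eq_sum_partialD, smul_eq_mul]
      rw [hclosed v hv 1 0]
      ring)
  have hXon : ContDiffOn ℝ ∞ X s := by
    rw [contDiffOn_infty_iff_fderiv_of_isOpen hso]
    refine ⟨fun v hv => (hX v hv).differentiableAt.differentiableWithinAt, ?_⟩
    exact ContDiffOn.congr (fun v hv => (hPs v hv).contDiffWithinAt) fun v hv => (hX v hv).fderiv
  refine ⟨X, fun v hv => ⟨hXon.contDiffAt (hso.mem_nhds hv), fun y => ?_⟩⟩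
  rw [(hX v hv).fderiv]
  simp [hP]

/-- A closed nondegenerate coframe is, locally, the coframe of a coordinate system; the
coordinates may be taken to range over a disc. -/
lemma exists_coordinates {U : Set Plane} (hU : IsOpen U) {p q : Fin 2 → Plane → ℝ}
    (hp : ∀ i, ∀ v ∈ U, ContDiffAt ℝ ∞ (p i) v) (hq : ∀ i, ∀ v ∈ U, ContDiffAt ℝ ∞ (q i) v)
    (hpc : ∀ v ∈ U, ∀ i j, partialD i (p j) v = partialD j (p i) v)
    (hqc : ∀ v ∈ U, ∀ i j, partialD i (q j) v = partialD j (q i) v)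
    (hd : ∀ v ∈ U, p 0 v * q 1 v - p 1 v * q 0 v ≠ 0) {u : Plane} (hu : u ∈ U) :
    ∃ (ψ : OpenPartialHomeomorph Plane Plane) (r : ℝ), u ∈ ψ.source ∧ ψ.source ⊆ U ∧
      ψ.target = Metric.ball (ψ u) r ∧ (∀ v ∈ ψ.source, ContDiffAt ℝ ∞ ψ v) ∧
      (∀ x ∈ ψ.target, ContDiffAt ℝ ∞ ψ.symm x) ∧
      ∀ v ∈ ψ.source, ∀ y, (fderiv ℝ ψ v y) 0 = p 0 v * y 0 + p 1 v * y 1 ∧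
        (fderiv ℝ ψ v y) 1 = q 0 v * y 0 + q 1 v * y 1 := by
  obtain ⟨R, hR, hball⟩ := Metric.isOpen_iff.1 hU u hu
  obtain ⟨X, hX⟩ := exists_potential (convex_ball u R) Metric.isOpen_ball
    (fun i v hv => hp i v (hball hv)) (fun v hv => hpc v (hball hv))
  obtain ⟨Y, hY⟩ := exists_potential (convex_ball u R) Metric.isOpen_ball
    (fun i v hv => hq i v (hball hv)) (fun v hv => hqc v (hball hv))
  set Ψ : Plane → Plane := fun v => !₂[X v, Y v] with hΨ
  have hΨs : ∀ v ∈ Metric.ball u R, ContDiffAt ℝ ∞ Ψ v := fun v hv => by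
    rw [contDiffAt_euclidean, Fin.forall_fin_two]
    exact ⟨(hX v hv).1, (hY v hv).1⟩
  have hΨd : ∀ v ∈ Metric.ball u R, ∀ y, (fderiv ℝ Ψ v y) 0 = p 0 v * y 0 + p 1 v * y 1 ∧
        (fderiv ℝ Ψ v y) 1 = q 0 v * y 0 + q 1 v * y 1 := by
    intro v hv y
    have hh := (differentiableAt_of_smooth (hΨs v hv)).hasFDerivAt
    rw [← (hX v hv).2, ← (hY v hv).2]
    have hc : ∀ i, fderiv ℝ (fun v => Ψ v i) v y = (fderiv ℝ Ψ v y) i := fun i => by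
      have := ((EuclideanSpace.proj i : Plane →L[ℝ] ℝ).hasFDerivAt.comp v hh).fderiv
      exact congrArg (fun L : Plane →L[ℝ] ℝ => L y) this
    exact ⟨(hc 0).symm, (hc 1).symm⟩
  have hequiv : ∀ v ∈ Metric.ball u R, ∃ A : Plane ≃L[ℝ] Plane,
      HasFDerivAt Ψ (A : Plane →L[ℝ] Plane) v := by
    intro v hv
    have hinj : Function.Injective (fderiv ℝ Ψ v : Plane →ₗ[ℝ] Plane) := by
      rw [← LinearMap.ker_eq_bot, LinearMap.ker_eq_bot']
      intro y hy
      obtain ⟨h0, h1⟩ := hΨd v hv y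
      have hy' : fderiv ℝ Ψ v y = 0 := hy
      rw [hy'] at h0 h1
      simp only [PiLp.zero_apply] at h0 h1
      have hdv := hd v (hball hv)
      ext i
      revert i
      rw [Fin.forall_fin_two]
      constructor
      · apply mul_left_cancel₀ hdv
        simp only [PiLp.zero_apply]
        linear_combination p 1 v * h1 - q 1 v * h0
      · apply mul_left_cancel₀ hdv
        simp only [PiLp.zero_apply]
        linear_combination q 0 v * h0 - p 0 v * h1
    refine ⟨(LinearEquiv.ofInjectiveEndo _ hinj).toContinuousLinearEquiv, ?_⟩
    have hA : ((LinearEquiv.ofInjectiveEndo _ hinj).toContinuousLinearEquiv : Plane →L[ℝ] Plane) =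
        fderiv ℝ Ψ v := by ext1 y; rfl
    rw [hA]
    exact (differentiableAt_of_smooth (hΨs v hv)).hasFDerivAt
  have huR : u ∈ Metric.ball u R := Metric.mem_ball_self hR
  obtain ⟨A, hA⟩ := hequiv u huR
  set ψ₀ := (hΨs u huR).toOpenPartialHomeomorph Ψ hA (by simp) with hψ₀
  have hu₀ : u ∈ ψ₀.source := (hΨs u huR).mem_toOpenPartialHomeomorph_source hA (by simp)
  set ψ₁ := ψ₀.restrOpen (Metric.ball u R) Metric.isOpen_ball with hψ₁
  have hs₁ : ψ₁.source = ψ₀.source ∩ Metric.ball u R := ψ₀.restrOpen_source _ _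
  have hu₁ : u ∈ ψ₁.source := by rw [hs₁]; exact ⟨hu₀, huR⟩
  obtain ⟨r, hr, hball'⟩ := Metric.isOpen_iff.1 ψ₁.open_target _ (ψ₁.map_source hu₁)
  set ψ := (ψ₁.symm.restrOpen (Metric.ball (ψ₁ u) r) Metric.isOpen_ball).symm with hψ
  have htgt : ψ.target = Metric.ball (ψ₁ u) r := by
    have : ψ.target = ψ₁.symm.source ∩ Metric.ball (ψ₁ u) r :=
      ψ₁.symm.restrOpen_source _ Metric.isOpen_ball
    rw [this]
    exact Set.inter_eq_right.2 hball'
  have hcoe : (ψ : Plane → Plane) = Ψ := rfl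
  have hsrc : ∀ v ∈ ψ.source, v ∈ Metric.ball u R := fun v hv => by
    have hx : ψ v ∈ ψ₁.target := hball' (htgt ▸ ψ.map_source hv)
    have hv' : ψ₁.symm (ψ v) ∈ ψ₁.source := ψ₁.map_target hx
    have : ψ₁.symm (ψ v) = v := ψ.left_inv hv
    rw [this, hs₁] at hv'
    exact hv'.2
  refine ⟨ψ, r, ?_, fun v hv => hball (hsrc v hv), htgt, fun v hv => hΨs v (hsrc v hv),
    fun x hx => ?_, fun v hv => hΨd v (hsrc v hv)⟩
  · have hx : ψ₁ u ∈ ψ.target := by rw [htgt]; exact Metric.mem_ball_self hr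
    have : ψ.symm (ψ₁ u) = u := ψ₁.left_inv hu₁
    rw [← this]
    exact ψ.map_target hx
  · have hv := hsrc _ (ψ.map_target hx)
    obtain ⟨B, hB⟩ := hequiv _ hv
    exact ψ.contDiffAt_symm hx hB (hΨs _ hv)

/-- The coordinate expression of a map `Z` with `dZ = dx ⊗ E`. -/
lemma hasFDerivAt_comp_symm {ψ : OpenPartialHomeomorph Plane Plane} {p : Fin 2 → Plane → ℝ}
    {V : Type*} [NormedAddCommGroup V] [NormedSpace ℝ V] {Z E : Plane → V} {x : Plane}
    (hx : x ∈ ψ.target) (h₁ : DifferentiableAt ℝ ψ (ψ.symm x))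
    (h₂ : DifferentiableAt ℝ ψ.symm x)
    (hψ : ∀ y, (fderiv ℝ ψ (ψ.symm x) y) 0 = p 0 (ψ.symm x) * y 0 + p 1 (ψ.symm x) * y 1)
    (hZ : DifferentiableAt ℝ Z (ψ.symm x))
    (hdZ : ∀ i, partialD i Z (ψ.symm x) = p i (ψ.symm x) • E (ψ.symm x)) :
    HasFDerivAt (fun x => Z (ψ.symm x))
      ((EuclideanSpace.proj 0 : Plane →L[ℝ] ℝ).smulRight (E (ψ.symm x))) x := by
  have hid : ∀ y, fderiv ℝ ψ (ψ.symm x) (fderiv ℝ ψ.symm x y) = y := by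
    intro y
    have hc := (h₁.hasFDerivAt.comp x h₂.hasFDerivAt).fderiv
    have he : (ψ ∘ ψ.symm) =ᶠ[𝓝 x] id :=
      ψ.eventually_right_inverse hx
    rw [he.fderiv_eq, fderiv_id] at hc
    exact (congrArg (fun L : Plane →L[ℝ] Plane => L y) hc).symm
  have hL : (EuclideanSpace.proj 0 : Plane →L[ℝ] ℝ).smulRight (E (ψ.symm x)) =
      (fderiv ℝ Z (ψ.symm x)).comp (fderiv ℝ ψ.symm x) := by
    ext1 y
    have h0 := hψ (fderiv ℝ ψ.symm x y)
    rw [hid] at h0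
    rw [ContinuousLinearMap.comp_apply, fderiv_eq_sum_partialD, hdZ, hdZ]
    change y 0 • E (ψ.symm x) = _
    rw [h0]
    module
  rw [hL]
  exact hZ.hasFDerivAt.comp x h₂.hasFDerivAt

section Slices

variable {V : Type*} [NormedAddCommGroup V] [NormedSpace ℝ V] {G E : Plane → V}
  {c : Plane} {r : ℝ}

lemma mem_ball_slice {s t : ℝ} (h : !₂[s, t] ∈ Metric.ball c r) : !₂[s, c 1] ∈ Metric.ball c r := by
  rw [Metric.mem_ball, EuclideanSpace.dist_eq] at h ⊢
  refine lt_of_le_of_lt (Real.sqrt_le_sqrt ?_) h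
  simp

lemma mem_ball_of_mem_Ioo {s : ℝ} (h : s ∈ Set.Ioo (c 0 - r) (c 0 + r)) :
    !₂[s, c 1] ∈ Metric.ball c r := by
  rw [Metric.mem_ball, EuclideanSpace.dist_eq]
  simp only [Fin.sum_univ_two, Real.dist_eq, sq_abs]
  simp only [Matrix.cons_val_zero, Matrix.cons_val_one, Matrix.cons_val_fin_one, sub_self]
  rw [zero_pow two_ne_zero, add_zero, Real.sqrt_sq_eq_abs, abs_lt]
  constructor <;> linarith [h.1, h.2]

lemma fst_mem_Ioo {x : Plane} (h : x ∈ Metric.ball c r) : x 0 ∈ Set.Ioo (c 0 - r) (c 0 + r) := by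
  rw [Metric.mem_ball, EuclideanSpace.dist_eq] at h
  have : |x 0 - c 0| < r := by
    refine lt_of_le_of_lt ?_ h
    rw [← Real.sqrt_sq_eq_abs]
    apply Real.sqrt_le_sqrt
    simp only [Fin.sum_univ_two, Real.dist_eq, sq_abs]
    linarith [sq_nonneg (x 1 - c 1)]
  rw [abs_lt] at this
  constructor <;> linarith

lemma hasDerivAt_slice_fst (t s : ℝ) :
    HasDerivAt (fun s : ℝ => (!₂[s, t] : Plane)) (EuclideanSpace.single 0 1) s := by
  have e : (fun s : ℝ => (!₂[s, t] : Plane)) =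
      fun s => s • EuclideanSpace.single 0 1 + t • EuclideanSpace.single 1 1 := by
    ext s k; fin_cases k <;> simp
  rw [e]
  simpa using ((hasDerivAt_id s).smul_const (EuclideanSpace.single 0 (1 : ℝ))).add_const
    (t • EuclideanSpace.single (1 : Fin 2) (1 : ℝ))

/-- A map on a disc whose differential is a multiple of `dx` only depends on `x`. -/
lemma eq_slice_of_hasFDerivAt (hG : ∀ x ∈ Metric.ball c r,
      HasFDerivAt G ((EuclideanSpace.proj 0 : Plane →L[ℝ] ℝ).smulRight (E x)) x)
    {x : Plane} (hx : x ∈ Metric.ball c r) : G x = G !₂[x 0, c 1] := by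
  have hx' : x = !₂[x 0, x 1] := by ext i; fin_cases i <;> rfl
  set γ : ℝ →ᵃ[ℝ] Plane := AffineMap.lineMap !₂[x 0, c 1] x with hγ
  have hy : !₂[x 0, c 1] ∈ Metric.ball c r := mem_ball_slice (hx' ▸ hx)
  have hseg : ∀ t ∈ Set.Icc (0 : ℝ) 1, γ t ∈ Metric.ball c r := fun t ht =>
    (convex_ball c r).lineMap_mem hy hx ht
  have hder : ∀ t ∈ Set.Icc (0 : ℝ) 1, HasDerivAt (fun t => G (γ t)) 0 t := by
    intro t ht
    have := (hG _ (hseg t ht)).comp_hasDerivAt t (AffineMap.hasDerivAt_lineMap (a := !₂[x 0, c 1])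
      (b := x) (x := t))
    simpa [Function.comp_def] using this
  have := constant_of_has_deriv_right_zero (f := fun t => G (γ t)) (a := 0) (b := 1)
    (fun t ht => (hder t ht).continuousAt.continuousWithinAt)
    (fun t ht => (hder t ⟨ht.1, ht.2.le⟩).hasDerivWithinAt) 1 (by simp)
  simpa [hγ] using this

lemma hasDerivAt_slice (hG : ∀ x ∈ Metric.ball c r,
      HasFDerivAt G ((EuclideanSpace.proj 0 : Plane →L[ℝ] ℝ).smulRight (E x)) x)
    {s : ℝ} (hs : s ∈ Set.Ioo (c 0 - r) (c 0 + r)) :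
    HasDerivAt (fun s => G !₂[s, c 1]) (E !₂[s, c 1]) s := by
  have := (hG _ (mem_ball_of_mem_Ioo hs)).comp_hasDerivAt s (hasDerivAt_slice_fst (c 1) s)
  simpa [Function.comp_def] using this

end Slices

/-! ### The normal form -/

/-- The phase `e^{it}`. -/
def phase (t : ℝ) : ℂ := Complex.exp (Complex.I * (t : ℂ))

lemma phase_mul_conj (t : ℝ) : phase t * (starRingEnd ℂ) (phase t) = 1 := by
  rw [phase, ← Complex.exp_conj, ← Complex.exp_add]
  simp

lemma phase_ne_zero (t : ℝ) : phase t ≠ 0 := Complex.exp_ne_zero _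

lemma phase_add (s t : ℝ) : phase (s + t) = phase s * phase t := by
  rw [phase, phase, phase, ← Complex.exp_add]; congr 1; push_cast; ring

lemma phase_zero : phase 0 = 1 := by simp [phase]

lemma contDiff_phase : ContDiff ℝ ∞ phase :=
  Complex.contDiff_exp.comp (contDiff_const.mul Complex.ofRealCLM.contDiff)

lemma hasDerivAt_phase (t : ℝ) : HasDerivAt phase (Complex.I * phase t) t := by
  have h1 : HasDerivAt (fun t : ℝ => Complex.I * (t : ℂ)) Complex.I t := by
    simpa using (Complex.ofRealCLM.hasDerivAt (x := t)).const_mul Complex.I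
  have := h1.cexp
  rw [mul_comm] at this
  exact this

lemma herm_phase_smul (t : ℝ) (x y : C21) : herm (phase t • x) (phase t • y) = herm x y := by
  rw [herm_smul_left, herm_smul_right, ← mul_assoc, phase_mul_conj, one_mul]

/-- The derivative of `e^{iY} F`. -/
lemma partialD_phase_smul {Y : Plane → ℝ} {F : Plane → C21} {u : Plane} {i : Fin 2}
    (hY : DifferentiableAt ℝ Y u) (hF : DifferentiableAt ℝ F u) :
    partialD i (fun v => phase (Y v) • F v) u =
      phase (Y u) • (partialD i F u + (Complex.I * (partialD i Y u : ℝ)) • F u) := by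
  have h1 := ((hasDerivAt_phase (Y u)).hasFDerivAt.comp u hY.hasFDerivAt)
  have h2 : partialD i (fun v => phase (Y v)) u =
      (partialD i Y u : ℝ) * (Complex.I * phase (Y u)) := by
    have := h1.fderiv
    simp only [Function.comp_def] at this
    rw [partialD, this]
    simp [partialD]
  have h3 : DifferentiableAt ℝ (fun v => phase (Y v)) u := h1.differentiableAt
  rw [partialD_smul h3 hF, h2]
  module

namespace IsAdaptedFrameOn

variable {U : Set Plane} {f e₁ e₂ : Plane → C21} {p q : Fin 2 → Plane → ℝ}
    {w lam m : Plane → ℝ} (h : IsAdaptedFrameOn U f e₁ e₂ p q w lam m)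
include h

/-- If the coefficient `m` vanishes, then so does the connection form. -/
lemma w_eq_zero (hm : ∀ v ∈ U, m v = 0) {v : Plane} (hv : v ∈ U) : w v = 0 := by
  have e : m =ᶠ[𝓝 v] fun _ => 0 := (h.eventually_mem hv).mono hm
  have key := h.mixed_partials_snd hv 0 1
  rw [partialD_congr e, partialD_congr e, partialD_const, partialD_const] at key
  refine (mul_eq_zero.1 (?_ : w v * (p 0 v * q 1 v - p 1 v * q 0 v) = 0)).resolve_right
    (h.det_ne_zero v hv)
  linear_combination -key

/-- Up to a translation, a surface with an adapted frame whose bitension field is lightlike is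
locally `e^{iy} z(x)` for a generating curve `z`. -/
theorem exists_normal_form (hlam : ∀ v ∈ U, lam v ≠ 0) (hm : ∀ v ∈ U, m v = 0)
    {u : Plane} (hu : u ∈ U) :
    ∃ ψ : OpenPartialHomeomorph Plane Plane, u ∈ ψ.source ∧ ψ.source ⊆ U ∧
      (∀ v ∈ ψ.source, ContDiffAt ℝ ∞ ψ v) ∧ (∀ x ∈ ψ.target, ContDiffAt ℝ ∞ ψ.symm x) ∧
      ∃ (I : Set ℝ) (z : ℝ → C21) (b : C21), IsGeneratingCurve 1 I z ∧
        ∀ x ∈ ψ.target, x 0 ∈ I ∧ f (ψ.symm x) = model 1 z x + b := by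
  have hw := fun v hv => h.w_eq_zero hm (v := v) hv
  obtain ⟨ψ, r, huψ, hψU, htgt, hs, hs', hdψ⟩ := exists_coordinates h.isOpen h.smooth_p h.smooth_q
    (fun v hv i j => by
      have := (h.mixed_partials_f hv i j).1
      rw [hw v hv] at this
      linear_combination this)
    (fun v hv i j => sub_eq_zero.1 (h.mixed_partials_f hv i j).2) h.det_ne_zero hu
  set c := ψ u with hc
  set Y : Plane → ℝ := fun v => -(ψ v 1) with hY
  have hYs : ∀ v ∈ ψ.source, ContDiffAt ℝ ∞ Y v := fun v hv =>
    ((contDiffAt_euclidean.1 (hs v hv)) 1).neg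
  have hYd : ∀ v ∈ ψ.source, ∀ i, partialD i Y v = -q i v := by
    intro v hv i
    have h1 := partialD_clm (i := i) (EuclideanSpace.proj 1 : Plane →L[ℝ] ℝ)
      (differentiableAt_of_smooth (hs v hv))
    have h2 := (hdψ v hv (EuclideanSpace.single i 1)).2
    have h3 : partialD i (fun v => ψ v 1) v = q i v := by
      refine h1.trans (h2.trans ?_)
      fin_cases i <;> simp
    rw [hY, partialD_neg, h3]
  have d₁ := fun v (hv : v ∈ ψ.source) => differentiableAt_of_smooth (h.smooth_fst v (hψU hv))
  have d₂ := fun v (hv : v ∈ ψ.source) => differentiableAt_of_smooth (h.smooth_snd v (hψU hv))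
  have dY := fun v (hv : v ∈ ψ.source) => differentiableAt_of_smooth (hYs v hv)
  -- `Z = e^{-iy} (-i e₂)` and its first two derivatives with respect to `x`
  set Z : Plane → C21 := fun v => phase (Y v) • (-Complex.I) • e₂ v with hZ
  set E : Plane → C21 := fun v => phase (Y v) • e₁ v with hE
  set L : Plane → C21 := fun v => phase (Y v) • (Complex.I * lam v) • e₂ v with hL
  have hZd : ∀ v ∈ ψ.source, ∀ i, partialD i Z v = p i v • E v := by
    intro v hv i
    rw [hZ, partialD_phase_smul (dY v hv) ((d₂ v hv).fun_const_smul _), hYd v hv,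
      partialD_const_smul _ (d₂ v hv), h.deriv_snd v (hψU hv), hm v (hψU hv), hw v (hψU hv)]
    simp only [hE]
    match_scalars <;> apply Complex.ext <;> simp <;> ring
  have hEd : ∀ v ∈ ψ.source, ∀ i, partialD i E v = p i v • L v := by
    intro v hv i
    rw [hE, partialD_phase_smul (dY v hv) (d₁ v hv), hYd v hv, h.deriv_fst v (hψU hv),
      hw v (hψU hv)]
    simp only [hL]
    match_scalars <;> apply Complex.ext <;> simp <;> ring
  have hZs : ∀ v ∈ ψ.source, ContDiffAt ℝ ∞ Z v := fun v hv =>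
    ((contDiff_phase.contDiffAt).comp v (hYs v hv)).smul
      ((h.smooth_snd v (hψU hv)).const_smul (-Complex.I))
  have hEs : ∀ v ∈ ψ.source, DifferentiableAt ℝ E v := fun v hv =>
    differentiableAt_of_smooth (((contDiff_phase.contDiffAt).comp v (hYs v hv)).smul
      (h.smooth_fst v (hψU hv)))
  have hZx : ∀ x ∈ Metric.ball c r, HasFDerivAt (fun x => Z (ψ.symm x))
      ((EuclideanSpace.proj 0 : Plane →L[ℝ] ℝ).smulRight (E (ψ.symm x))) x := by
    intro x hx
    rw [← htgt] at hx
    have hv := ψ.map_target hx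
    exact hasFDerivAt_comp_symm hx (differentiableAt_of_smooth (hs _ hv))
      (differentiableAt_of_smooth (hs' x hx)) (fun y => (hdψ _ hv y).1)
      (differentiableAt_of_smooth (hZs _ hv)) (hZd _ hv)
  have hEx : ∀ x ∈ Metric.ball c r, HasFDerivAt (fun x => E (ψ.symm x))
      ((EuclideanSpace.proj 0 : Plane →L[ℝ] ℝ).smulRight (L (ψ.symm x))) x := by
    intro x hx
    rw [← htgt] at hx
    have hv := ψ.map_target hx
    exact hasFDerivAt_comp_symm hx (differentiableAt_of_smooth (hs _ hv))
      (differentiableAt_of_smooth (hs' x hx)) (fun y => (hdψ _ hv y).1)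
      (hEs _ hv) (hEd _ hv)
  -- `f + i e₂` is constant
  have hconst : ∀ x ∈ Metric.ball c r,
      f (ψ.symm x) + Complex.I • e₂ (ψ.symm x) = f u + Complex.I • e₂ u := by
    have hfx : ∀ x ∈ Metric.ball c r,
        HasFDerivAt (fun x => f (ψ.symm x) + Complex.I • e₂ (ψ.symm x))
        ((EuclideanSpace.proj 0 : Plane →L[ℝ] ℝ).smulRight (0 : C21)) x := by
      intro x hx
      rw [← htgt] at hx
      have hv := ψ.map_target hx
      have df := differentiableAt_of_smooth (h.smooth_f _ (hψU hv))
      refine hasFDerivAt_comp_symm (E := fun _ => 0) hx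
        (differentiableAt_of_smooth (hs _ hv)) (differentiableAt_of_smooth (hs' x hx))
        (fun y => (hdψ _ hv y).1) (df.fun_add ((d₂ _ hv).fun_const_smul Complex.I)) (fun i => ?_)
      rw [partialD_add df ((d₂ _ hv).fun_const_smul _), partialD_const_smul _ (d₂ _ hv),
        h.deriv_f _ (hψU hv), h.deriv_snd _ (hψU hv), hm _ (hψU hv), hw _ (hψU hv), smul_zero]
      match_scalars <;> apply Complex.ext <;> simp
    intro x hx
    have hr : 0 < r := by
      have := hx
      rw [Metric.mem_ball] at this
      exact lt_of_le_of_lt dist_nonneg this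
    have := Metric.isOpen_ball.is_const_of_fderiv_eq_zero (𝕜 := ℝ)
      (convex_ball c r).isPreconnected
      (fun x hx => (hfx x hx).differentiableAt.differentiableWithinAt)
      (fun x hx => by rw [(hfx x hx).fderiv]; exact ContinuousLinearMap.smulRight_zero _) hx
      (Metric.mem_ball_self hr)
    rw [hc, ψ.left_inv huψ] at this
    exact this
  refine ⟨ψ, huψ, hψU, hs, hs', Set.Ioo (c 0 - r) (c 0 + r), fun s => Z (ψ.symm !₂[s, c 1]),
    f u + Complex.I • e₂ u, ?_, ?_⟩
  · have hmem : ∀ s ∈ Set.Ioo (c 0 - r) (c 0 + r), ψ.symm !₂[s, c 1] ∈ ψ.source := fun s hs =>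
      ψ.map_target (htgt ▸ mem_ball_of_mem_Ioo hs)
    have hz' : ∀ s ∈ Set.Ioo (c 0 - r) (c 0 + r),
        deriv (fun s => Z (ψ.symm !₂[s, c 1])) s = E (ψ.symm !₂[s, c 1]) := fun s hs =>
      (hasDerivAt_slice (G := fun x => Z (ψ.symm x)) (E := fun x => E (ψ.symm x)) hZx hs).deriv
    have hz'' : ∀ s ∈ Set.Ioo (c 0 - r) (c 0 + r),
        deriv (deriv (fun s => Z (ψ.symm !₂[s, c 1]))) s = L (ψ.symm !₂[s, c 1]) := fun s hs => by
      have he : deriv (fun s => Z (ψ.symm !₂[s, c 1])) =ᶠ[𝓝 s] fun s => E (ψ.symm !₂[s, c 1]) :=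
        Filter.mem_of_superset (isOpen_Ioo.mem_nhds hs) hz'
      rw [he.deriv_eq]
      exact (hasDerivAt_slice (G := fun x => E (ψ.symm x)) (E := fun x => L (ψ.symm x)) hEx
        hs).deriv
    have hpair := fun s hs => h.nullPair _ (hψU (hmem s hs))
    refine ⟨isOpen_Ioo, Set.ordConnected_Ioo, fun s hs => ?_, fun s hs => ?_, fun s hs => ?_,
      fun s hs => ?_, fun s hs => ?_⟩
    · have hsl : ContDiffAt ℝ ∞ (fun s : ℝ => (!₂[s, c 1] : Plane)) s := by
        rw [contDiffAt_euclidean, Fin.forall_fin_two]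
        exact ⟨contDiffAt_id, contDiffAt_const⟩
      have h1 := (hs' _ (htgt ▸ mem_ball_of_mem_Ioo hs)).comp s hsl
      exact ((hZs _ (hmem s hs)).comp s h1).contDiffWithinAt
    · rw [hz' s hs, Lightlike, lorentz_self_eq_zero_iff]
      refine ⟨smul_ne_zero (phase_ne_zero _) (hpair s hs).left_ne_zero, ?_⟩
      simp only [hE]
      rw [herm_phase_smul, (hpair s hs).left_null]
    · refine (lorentz_self_eq_zero_iff _).2 ?_
      simp only [hZ]
      rw [herm_phase_smul, herm_smul_left, herm_smul_right, (hpair s hs).right_null]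
      simp
    · rw [hz' s hs]
      simp only [hZ, hE]
      rw [smul_comm Complex.I, lorentz_eq_re_herm, herm_phase_smul, herm_smul_left,
        herm_smul_right, (hpair s hs).pairing_symm]
      simp
    · rw [hz'' s hs]
      exact smul_ne_zero (phase_ne_zero _) (smul_ne_zero (mul_ne_zero Complex.I_ne_zero
        (Complex.ofReal_ne_zero.2 (hlam _ (hψU (hmem s hs))))) (hpair s hs).right_ne_zero)
  · intro x hx
    have hxb : x ∈ Metric.ball c r := htgt ▸ hx
    refine ⟨fst_mem_Ioo hxb, ?_⟩
    have h1 : Z (ψ.symm x) = Z (ψ.symm !₂[x 0, c 1]) :=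
      eq_slice_of_hasFDerivAt (G := fun x => Z (ψ.symm x)) (E := fun x => E (ψ.symm x)) hZx hxb
    have h2 : Z (ψ.symm x) = phase (-(x 1)) • (-Complex.I) • e₂ (ψ.symm x) := by
      simp only [hZ, hY, ψ.right_inv hx]
    have h3 : model 1 (fun s => Z (ψ.symm !₂[s, c 1])) x = (-Complex.I) • e₂ (ψ.symm x) := by
      have h4 : model 1 (fun s => Z (ψ.symm !₂[s, c 1])) x = phase (x 1) • Z (ψ.symm x) := by
        rw [h1]; simp [model, phase]
      rw [h4, h2, smul_smul, ← phase_add, add_neg_cancel, phase_zero, one_smul]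
    rw [h3, ← hconst x hxb]
    module

end IsAdaptedFrameOn

/-! ### The adapted frame of a model surface -/

lemma IsHolomorphicIsometry.exists_eq {A : C21 → C21} (hA : IsHolomorphicIsometry A) :
    ∃ (T : C21 →L[ℂ] C21) (b : C21), (∀ v w, lorentz (T v) (T w) = lorentz v w) ∧
      Function.Injective T ∧ ∀ v, A v = T v + b := by
  obtain ⟨L, b, h1, h2⟩ := hA
  exact ⟨LinearMap.toContinuousLinearMap (L : C21 →ₗ[ℂ] C21), b, h1, L.injective, h2⟩

namespace IsGeneratingCurve

variable {μ : ℝ} {I : Set ℝ} {z : ℝ → C21}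

lemma contDiffAt (h : IsGeneratingCurve μ I z) {s : ℝ} (hs : s ∈ I) : ContDiffAt ℝ ∞ z s :=
  h.smooth.contDiffAt (h.isOpen.mem_nhds hs)

lemma contDiffAt_deriv {V : Type*} [NormedAddCommGroup V] [NormedSpace ℝ V] {z : ℝ → V} {s : ℝ}
    (h : ContDiffAt ℝ ∞ z s) : ContDiffAt ℝ ∞ (deriv z) s :=
  (h.fderiv_right (m := ∞) (by simp)).clm_apply contDiffAt_const

lemma eventually_mem (h : IsGeneratingCurve μ I z) {s : ℝ} (hs : s ∈ I) : ∀ᶠ t in 𝓝 s, t ∈ I :=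
  h.isOpen.mem_nhds hs

/-- A linear isometry maps generating curves to generating curves. -/
lemma map (h : IsGeneratingCurve μ I z) (T : C21 →L[ℂ] C21)
    (hT : ∀ v w, lorentz (T v) (T w) = lorentz v w) (hinj : Function.Injective T) :
    IsGeneratingCurve μ I (fun s => T (z s)) := by
  have hd : ∀ {y : ℝ → C21} {s}, DifferentiableAt ℝ y s →
      deriv (fun s => T (y s)) s = T (deriv y s) := fun {y s} hy =>
    ((T.restrictScalars ℝ).hasFDerivAt.comp_hasDerivAt s hy.hasDerivAt).deriv
  have h1 : ∀ s ∈ I, deriv (fun s => T (z s)) s = T (deriv z s) := fun s hs =>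
    hd ((h.contDiffAt hs).differentiableAt (by simp))
  have h2 : ∀ s ∈ I, deriv (deriv (fun s => T (z s))) s = T (deriv (deriv z) s) := fun s hs => by
    have he : deriv (fun s => T (z s)) =ᶠ[𝓝 s] fun s => T (deriv z s) :=
      (h.eventually_mem hs).mono h1
    rw [he.deriv_eq]
    exact hd ((contDiffAt_deriv (h.contDiffAt hs)).differentiableAt (by simp))
  have h0 : ∀ v, v ≠ 0 → T v ≠ 0 := fun v hv h0 => hv (hinj (h0.trans (map_zero T).symm))
  refine ⟨h.isOpen, h.interval, (T.restrictScalars ℝ).contDiff.comp_contDiffOn h.smooth,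
    fun s hs => ?_, fun s hs => ?_, fun s hs => ?_, fun s hs => ?_⟩
  · rw [h1 s hs, Lightlike, hT]
    exact ⟨h0 _ (h.null s hs).1, (h.null s hs).2⟩
  · exact (hT _ _).trans (h.mem_lightCone s hs)
  · rw [h1 s hs, ← map_smul, hT]
    exact h.normalized s hs
  · rw [h2 s hs]
    exact h0 _ (h.second_ne_zero s hs)

lemma hasDerivAt_herm {x y : ℝ → C21} {x' y' : C21} {s : ℝ} (hx : HasDerivAt x x' s)
    (hy : HasDerivAt y y' s) :
    HasDerivAt (fun s => herm (x s) (y s)) (herm x' (y s) + herm (x s) y') s := by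
  have := hermL.hasDerivAt_of_bilinear (u := x) (v := y) (fun _ => hx)
    (fun _ => hy)
  rw [add_comm] at this
  exact this

variable (h : IsGeneratingCurve μ I z) (hμ : μ ≠ 0) {s : ℝ} (hs : s ∈ I)

include h hs in
lemma herm_self : herm (z s) (z s) = 0 := (lorentz_self_eq_zero_iff _).1 (h.mem_lightCone s hs)

include h hs in
lemma herm_deriv_deriv : herm (deriv z s) (deriv z s) = 0 :=
  (lorentz_self_eq_zero_iff _).1 (h.null s hs).2

include h hs in
lemma hasDerivAt : HasDerivAt z (deriv z s) s :=
  ((h.contDiffAt hs).differentiableAt (by simp)).hasDerivAt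

include h hs in
lemma hasDerivAt_deriv : HasDerivAt (deriv z) (deriv (deriv z) s) s :=
  ((contDiffAt_deriv (h.contDiffAt hs)).differentiableAt (by simp)).hasDerivAt

include h hs in
lemma herm_deriv : herm (deriv z s) (z s) = ⟨0, -μ⁻¹⟩ := by
  have h1 := hasDerivAt_herm (h.hasDerivAt hs) (h.hasDerivAt hs)
  have he : (fun s => herm (z s) (z s)) =ᶠ[𝓝 s] fun _ => 0 :=
    (h.eventually_mem hs).mono fun t ht => h.herm_self ht
  have h2 := (h1.congr_of_eventuallyEq he.symm).unique (hasDerivAt_const s 0)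
  rw [← herm_conj (deriv z s) (z s)] at h2
  have h3 := congrArg Complex.re h2
  have h4 := h.normalized s hs
  rw [lorentz_eq_re_herm, herm_smul_right, ← herm_conj (deriv z s) (z s)] at h4
  simp at h3 h4
  apply Complex.ext
  · exact h3
  · simp only; linarith

include h hμ hs in
lemma isNullPair : IsNullPair (μ • deriv z s) (Complex.I • z s) := by
  refine ⟨?_, ?_, ?_⟩
  · rw [herm_real_smul_left, herm_real_smul_right, h.herm_deriv_deriv hs]; simp
  · rw [herm_smul_left, herm_smul_right, h.herm_self hs]; simp
  · rw [herm_real_smul_left, herm_smul_right, h.herm_deriv hs]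
    apply Complex.ext <;> simp [hμ]

include h hμ hs in
/-- A generating curve satisfies `z'' = ρ μ z` for a real function `ρ`. -/
lemma deriv_deriv_eq : deriv (deriv z) s =
    ((herm (deriv (deriv z) s) (deriv z s)).im * μ) • z s := by
  have h1 := hasDerivAt_herm (h.hasDerivAt_deriv hs) (h.hasDerivAt hs)
  have he : (fun s => herm (deriv z s) (z s)) =ᶠ[𝓝 s] fun _ => ⟨0, -μ⁻¹⟩ :=
    (h.eventually_mem hs).mono fun t ht => h.herm_deriv ht
  have h2 := (h1.congr_of_eventuallyEq he.symm).unique (hasDerivAt_const s _)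
  rw [h.herm_deriv_deriv hs, add_zero] at h2
  have h3 := hasDerivAt_herm (h.hasDerivAt_deriv hs) (h.hasDerivAt_deriv hs)
  have he' : (fun s => herm (deriv z s) (deriv z s)) =ᶠ[𝓝 s] fun _ => 0 :=
    (h.eventually_mem hs).mono fun t ht => h.herm_deriv_deriv ht
  have h4 := (h3.congr_of_eventuallyEq he'.symm).unique (hasDerivAt_const s 0)
  rw [← herm_conj (deriv (deriv z) s) (deriv z s)] at h4
  have h5 : (herm (deriv (deriv z) s) (deriv z s)).re = 0 := by
    have := congrArg Complex.re h4
    simpa using this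
  have h6 : herm (z s) (deriv z s) = ⟨0, μ⁻¹⟩ := by
    rw [← herm_conj, h.herm_deriv hs]
    apply Complex.ext <;> simp
  apply (h.isNullPair hμ hs).ext_herm
  · rw [herm_real_smul_right, herm_real_smul_left, herm_real_smul_right, h6]
    apply Complex.ext
    · simp [h5]
    · simp
      field_simp
  · rw [herm_smul_right, herm_real_smul_left, herm_smul_right, h2, h.herm_self hs]
    simp

end IsGeneratingCurve

/-- A reparametrization of a model surface has an adapted frame, with vanishing connection form
and lightlike bitension field. -/
theorem IsGeneratingCurve.isAdaptedFrameOn {μ : ℝ} {I : Set ℝ} {z : ℝ → C21}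
    (h : IsGeneratingCurve μ I z) (hμ : μ ≠ 0) {U : Set Plane} (hU : IsOpen U) {ψ : Plane → Plane}
    (hψ : ∀ v ∈ U, ContDiffAt ℝ ∞ ψ v) (hinj : ∀ v ∈ U, Function.Injective (fderiv ℝ ψ v))
    (hI : ∀ v ∈ U, ψ v 0 ∈ I) {f : Plane → C21} {b : C21}
    (hf : ∀ v ∈ U, f v = model μ z (ψ v) + b) :
    ∃ e₁ e₂ p q lam, IsAdaptedFrameOn U f e₁ e₂ p q (fun _ => 0) lam (fun _ => 0) ∧
      ∀ v ∈ U, lam v ≠ 0 := by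
  set X : Plane → ℝ := fun v => ψ v 0 with hX
  set Y : Plane → ℝ := fun v => μ * ψ v 1 with hY
  set ρ : ℝ → ℝ := fun s => (herm (deriv (deriv z) s) (deriv z s)).im with hρ
  have mem : ∀ {v}, v ∈ U → ∀ᶠ v' in 𝓝 v, v' ∈ U := fun hv => hU.mem_nhds hv
  have sX : ∀ v ∈ U, ContDiffAt ℝ ∞ X v := fun v hv => contDiffAt_euclidean.1 (hψ v hv) 0
  have sY₀ : ∀ v ∈ U, ContDiffAt ℝ ∞ (fun v => ψ v 1) v := fun v hv =>
    contDiffAt_euclidean.1 (hψ v hv) 1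
  have sY : ∀ v ∈ U, ContDiffAt ℝ ∞ Y v := fun v hv => contDiffAt_const.mul (sY₀ v hv)
  have sz : ∀ v ∈ U, ContDiffAt ℝ ∞ (fun v => z (X v)) v := fun v hv =>
    (h.contDiffAt (hI v hv)).comp v (sX v hv)
  have sz' : ∀ v ∈ U, ContDiffAt ℝ ∞ (fun v => deriv z (X v)) v := fun v hv =>
    ContDiffAt.comp (g := deriv z) v (contDiffAt_deriv (h.contDiffAt (hI v hv))) (sX v hv)
  have sz'' : ∀ v ∈ U, ContDiffAt ℝ ∞ (fun v => deriv (deriv z) (X v)) v := fun v hv =>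
    ContDiffAt.comp (g := deriv (deriv z)) v
      (contDiffAt_deriv (contDiffAt_deriv (h.contDiffAt (hI v hv)))) (sX v hv)
  have comp : ∀ {y : ℝ → C21} {y' : C21} {v : Plane}, v ∈ U → HasDerivAt y y' (X v) → ∀ i,
      partialD i (fun v => y (X v)) v = partialD i X v • y' := by
    intro y y' v hv hy i
    have := (hy.hasFDerivAt.comp v (differentiableAt_of_smooth (sX v hv)).hasFDerivAt).fderiv
    simp only [Function.comp_def] at this
    rw [partialD, this]
    simp [partialD]
  have dz : ∀ v ∈ U, ∀ i, partialD i (fun v => z (X v)) v = partialD i X v • deriv z (X v) :=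
    fun v hv => comp hv (h.hasDerivAt (hI v hv))
  have dz' : ∀ v ∈ U, ∀ i, partialD i (fun v => deriv z (X v)) v =
      partialD i X v • (ρ (X v) * μ) • z (X v) := fun v hv i => by
    rw [comp hv (h.hasDerivAt_deriv (hI v hv)), h.deriv_deriv_eq hμ (hI v hv)]
  have sphase : ∀ v ∈ U, ContDiffAt ℝ ∞ (fun v => phase (Y v)) v := fun v hv =>
    contDiff_phase.contDiffAt.comp v (sY v hv)
  have hmodel : ∀ v ∈ U, f v = phase (Y v) • z (X v) + b := fun v hv => by
    rw [hf v hv, model, phase, hY]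
    congr 3
    push_cast
    ring
  have sf : ∀ v ∈ U, ContDiffAt ℝ ∞ f v := fun v hv =>
    ((((sphase v hv).smul (sz v hv))).add contDiffAt_const).congr_of_eventuallyEq
      ((mem hv).mono hmodel)
  have det : ∀ v ∈ U, partialD 0 X v * partialD 1 (fun v => ψ v 1) v
      - partialD 1 X v * partialD 0 (fun v => ψ v 1) v ≠ 0 := by
    intro v hv
    refine coframe_det_ne_zero (p := (partialD · X v)) (q := (partialD · (fun v => ψ v 1) v))
      (a := EuclideanSpace.single 0 1) (b := EuclideanSpace.single 1 1) (hinj v hv) fun i => ?_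
    have hc : ∀ k, partialD i (fun v => ψ v k) v = partialD i ψ v k := fun k =>
      partialD_clm (EuclideanSpace.proj k : Plane →L[ℝ] ℝ) (differentiableAt_of_smooth (hψ v hv))
    simp only [hX, hc]
    ext k; fin_cases k <;> simp
  have dY : ∀ v ∈ U, ∀ i, partialD i Y v = μ * partialD i (fun v => ψ v 1) v := fun v hv i =>
    partialD_const_smul μ (differentiableAt_of_smooth (sY₀ v hv))
  have dfY := fun v hv => differentiableAt_of_smooth (sY v hv)
  have dfz := fun v hv => differentiableAt_of_smooth (sz v hv)
  have dfz' := fun v hv => differentiableAt_of_smooth (sz' v hv)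
  refine ⟨fun v => phase (Y v) • μ • deriv z (X v), fun v => phase (Y v) • Complex.I • z (X v),
    fun i v => μ⁻¹ * partialD i X v, fun i v => partialD i Y v,
    fun v => -(ρ (X v) * μ ^ 3), ⟨hU, sf, fun v hv => ?_, fun v hv => ?_, fun i v hv => ?_,
    fun i v hv => ?_, fun v hv => contDiffAt_const, fun v hv => ?_, fun v hv => contDiffAt_const,
    fun v hv => ?_, fun v hv => ?_, fun v hv i => ?_, fun v hv i => ?_, fun v hv i => ?_⟩,
    fun v hv => ?_⟩
  · exact (sphase v hv).smul ((sz' v hv).const_smul μ)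
  · exact (sphase v hv).smul ((sz v hv).const_smul Complex.I)
  · exact contDiffAt_const.mul (contDiffAt_partialD (sX v hv))
  · exact contDiffAt_partialD (sY v hv)
  · exact ((Complex.imCLM.contDiff.contDiffAt.comp v (contDiffAt_herm (sz'' v hv) (sz' v hv))).mul
      contDiffAt_const).neg
  · have hn := h.isNullPair hμ (hI v hv)
    refine ⟨?_, ?_, ?_⟩
    · rw [herm_phase_smul]; exact hn.left_null
    · rw [herm_phase_smul]; exact hn.right_null
    · rw [herm_phase_smul]; exact hn.pairing
  · have := det v hv
    simp only [dY v hv]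
    convert this using 1
    field_simp
  · have e : f =ᶠ[𝓝 v] fun v => phase (Y v) • z (X v) + b := (mem hv).mono hmodel
    have hd : DifferentiableAt ℝ (fun v => phase (Y v) • z (X v)) v :=
      differentiableAt_of_smooth ((sphase v hv).smul (sz v hv))
    rw [partialD_congr e, partialD_add hd (differentiableAt_const b), partialD_const, add_zero,
      partialD_phase_smul (dfY v hv) (dfz v hv), dz v hv]
    have : μ⁻¹ * partialD i X v * μ = partialD i X v := by field_simp
    conv_lhs => rw [← this]
    match_scalars <;> apply Complex.ext <;> simp <;> ring
  · rw [partialD_phase_smul (dfY v hv) ((dfz' v hv).fun_const_smul μ),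
      partialD_const_smul μ (dfz' v hv), dz' v hv]
    have : -(ρ (X v) * μ ^ 3) * (μ⁻¹ * partialD i X v) = -(ρ (X v) * μ ^ 2 * partialD i X v) := by
      field_simp
    rw [this]
    match_scalars <;> apply Complex.ext <;> simp <;> ring
  · rw [partialD_phase_smul (dfY v hv) ((dfz v hv).fun_const_smul Complex.I),
      partialD_const_smul Complex.I (dfz v hv), dz v hv]
    have : μ⁻¹ * partialD i X v * μ = partialD i X v := by field_simp
    conv_lhs => rw [← this]
    match_scalars <;> apply Complex.ext <;> simp <;> ring
  · refine neg_ne_zero.2 (mul_ne_zero (fun h0 => ?_) (pow_ne_zero 3 hμ))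
    apply h.second_ne_zero _ (hI v hv)
    rw [h.deriv_deriv_eq hμ (hI v hv)]
    change (ρ (X v) * μ) • z (X v) = 0
    rw [h0, zero_mul, zero_smul]

/-- An immersion with an adapted frame is Lagrangian, with nondegenerate induced metric. -/
lemma IsAdaptedFrameOn.isLagrangianImmersionOn {U : Set Plane} {f e₁ e₂ : Plane → C21}
    {p q : Fin 2 → Plane → ℝ} {w lam m : Plane → ℝ}
    (h : IsAdaptedFrameOn U f e₁ e₂ p q w lam m) : IsLagrangianImmersionOn U f := by
  have hdf : ∀ v ∈ U, ∀ y, fderiv ℝ f v y =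
      (((p 0 v * y 0 + p 1 v * y 1 : ℝ) : ℂ)) • e₁ v
        + (((q 0 v * y 0 + q 1 v * y 1 : ℝ) : ℂ)) • e₂ v := by
    intro v hv y
    rw [fderiv_eq_sum_partialD, h.deriv_f v hv, h.deriv_f v hv]
    match_scalars <;> apply Complex.ext <;> simp <;> ring
  have hsurj : ∀ v ∈ U, ∀ s t : ℝ, ∃ y, fderiv ℝ f v y = (s : ℂ) • e₁ v + (t : ℂ) • e₂ v := by
    intro v hv s t
    have hd := mul_inv_cancel₀ (h.det_ne_zero v hv)
    set d := (p 0 v * q 1 v - p 1 v * q 0 v)⁻¹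
    refine ⟨!₂[(s * q 1 v - t * p 1 v) * d, (t * p 0 v - s * q 0 v) * d], ?_⟩
    rw [hdf v hv]
    congr 3
    · simp only [Matrix.cons_val_zero, Matrix.cons_val_one, Matrix.cons_val_fin_one]
      linear_combination s * hd
    · simp only [Matrix.cons_val_zero, Matrix.cons_val_one, Matrix.cons_val_fin_one]
      linear_combination t * hd
  refine ⟨h.isOpen, h.smooth_f, fun v hv => ?_, fun v hv x hx => ?_, fun v hv ξ => ?_⟩
  · rw [injective_iff_map_eq_zero]
    intro y hy
    have hd := h.det_ne_zero v hv
    rw [hdf v hv] at hy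
    have h0 : (0 : C21) = (0 : ℂ) • e₁ v + (0 : ℂ) • e₂ v := by simp
    obtain ⟨h1, h2⟩ := (h.nullPair v hv).coeff_eq (hy.trans h0)
    rw [Complex.ofReal_eq_zero] at h1 h2
    ext i
    revert i
    rw [Fin.forall_fin_two]
    constructor <;> apply mul_left_cancel₀ hd <;> simp only [PiLp.zero_apply]
    · linear_combination q 1 v * h1 - p 1 v * h2
    · linear_combination p 0 v * h2 - q 0 v * h1
  · have hn := h.nullPair v hv
    obtain ⟨y₁, hy₁⟩ := hsurj v hv 1 0
    obtain ⟨y₂, hy₂⟩ := hsurj v hv 0 1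
    have h1 := hx y₁
    have h2 := hx y₂
    rw [hy₁] at h1
    rw [hy₂] at h2
    rw [hdf v hv] at h1 h2 ⊢
    simp only [Complex.ofReal_one, Complex.ofReal_zero, zero_smul, one_smul, add_zero, zero_add,
      lorentz_eq_re_herm, hn.herm_comb_left, hn.herm_comb_right, Complex.neg_re,
      Complex.ofReal_re, neg_eq_zero] at h1 h2
    rw [h1, h2]
    simp
  · have hn := h.nullPair v hv
    constructor
    · intro hξ
      obtain ⟨y₁, hy₁⟩ := hsurj v hv 1 0
      obtain ⟨y₂, hy₂⟩ := hsurj v hv 0 1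
      have h1 := hξ y₁
      have h2 := hξ y₂
      rw [hy₁] at h1
      rw [hy₂] at h2
      simp only [Complex.ofReal_one, Complex.ofReal_zero, zero_smul, one_smul, add_zero, zero_add,
        lorentz_eq_re_herm] at h1 h2
      obtain ⟨x, hx⟩ := hsurj v hv (-(herm ξ (e₂ v)).im) (-(herm ξ (e₁ v)).im)
      refine ⟨x, ?_⟩
      rw [hx]
      conv_lhs => rw [hn.decomp ξ]
      match_scalars <;> apply Complex.ext <;> simp [h1, h2]
    · rintro ⟨x, rfl⟩ y
      rw [lorentz_I_smul_left, hdf v hv, hdf v hv]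
      simp only [herm_add_left, herm_add_right, herm_smul_left, herm_smul_right, hn.left_null,
        hn.right_null, hn.pairing, hn.pairing_symm]
      simp

/-! ### Surfaces in charts -/

section Manifold

variable {M : Type*} [TopologicalSpace M] [ChartedSpace Plane M] {φ : M → C21}
  {e e' : OpenPartialHomeomorph M Plane}

lemma mdifferentiable_of_mem_maximalAtlas (he : e ∈ IsManifold.maximalAtlas (𝓡 2) ∞ M) :
    e.MDifferentiable (𝓡 2) (𝓡 2) :=
  ⟨(contMDiffOn_of_mem_maximalAtlas he).mdifferentiableOn (by simp),
    (contMDiffOn_symm_of_mem_maximalAtlas he).mdifferentiableOn (by simp)⟩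

lemma contDiffAt_comp_symm (he : e ∈ IsManifold.maximalAtlas (𝓡 2) ∞ M) {u : Plane}
    (hu : u ∈ e.target) (hφ : ContMDiffAt (𝓡 2) 𝓘(ℝ, C21) ∞ φ (e.symm u)) :
    ContDiffAt ℝ ∞ (φ ∘ e.symm) u :=
  contMDiffAt_iff_contDiffAt.1 (hφ.comp u (contMDiffAt_symm_of_mem_maximalAtlas he hu))

lemma contMDiffAt_of_comp_symm (he : e ∈ IsManifold.maximalAtlas (𝓡 2) ∞ M) {p : M}
    (hp : p ∈ e.source) (hf : ContDiffAt ℝ ∞ (φ ∘ e.symm) (e p)) :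
    ContMDiffAt (𝓡 2) 𝓘(ℝ, C21) ∞ φ p := by
  have h1 := (contMDiffAt_iff_contDiffAt.2 hf).comp p (contMDiffAt_of_mem_maximalAtlas he hp)
  refine h1.congr_of_eventuallyEq ?_
  filter_upwards [e.open_source.mem_nhds hp] with q hq
  simp [e.left_inv hq]

lemma fderiv_comp_symm (he : e ∈ IsManifold.maximalAtlas (𝓡 2) ∞ M) {u : Plane}
    (hu : u ∈ e.target) (hφ : ContMDiffAt (𝓡 2) 𝓘(ℝ, C21) ∞ φ (e.symm u)) :
    ∃ D : Plane →ₗ[ℝ] Plane, Function.Bijective D ∧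
      ∀ y, fderiv ℝ (φ ∘ e.symm) u y = mfderiv (𝓡 2) 𝓘(ℝ, C21) φ (e.symm u) (D y) := by
  have hm := mdifferentiable_of_mem_maximalAtlas he
  refine ⟨(mfderiv (𝓡 2) (𝓡 2) e.symm u).toLinearMap, hm.symm.mfderiv_bijective hu, fun y => ?_⟩
  have h1 := mfderiv_comp u (hφ.mdifferentiableAt (by simp)) (hm.mdifferentiableAt_symm hu)
  rw [mfderiv_eq_fderiv] at h1
  exact congrArg (fun L : Plane →L[ℝ] C21 => L y) h1

/-- In a chart, a Lagrangian surface is a Lagrangian immersion of an open set of the plane. -/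
lemma isLagrangianImmersionOn_comp_symm (h : IsPseudoRiemannianImmersion φ) (hL : IsLagrangian φ)
    (he : e ∈ IsManifold.maximalAtlas (𝓡 2) ∞ M) :
    IsLagrangianImmersionOn e.target (φ ∘ e.symm) := by
  refine ⟨e.open_target, fun u hu => contDiffAt_comp_symm he hu h.smooth.contMDiffAt,
    fun u hu => ?_, fun u hu x hx => ?_, fun u hu ξ => ?_⟩
  all_goals obtain ⟨D, hD, hfD⟩ := fderiv_comp_symm he hu h.smooth.contMDiffAt
  · intro x y hxy
    rw [hfD, hfD] at hxy
    exact hD.1 (h.immersive _ hxy)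
  · apply h.nondegenerate (e.symm u) _ ⟨D x, (hfD x).symm⟩
    rintro _ ⟨y, rfl⟩
    obtain ⟨y, rfl⟩ := hD.2 y
    have := hx y
    rw [hfD y] at this
    exact this
  · have hn : ξ ∈ normalPlane φ (e.symm u) ↔ ∀ y, lorentz ξ (fderiv ℝ (φ ∘ e.symm) u y) = 0 := by
      constructor
      · intro hξ y
        exact hξ _ ⟨D y, (hfD y).symm⟩
      · rintro hξ _ ⟨y, rfl⟩
        obtain ⟨y, rfl⟩ := hD.2 y
        have := hξ y
        rw [hfD y] at this
        exact this
    rw [← hn, ← (hL (e.symm u)).1]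
    constructor
    · rintro ⟨_, ⟨y, rfl⟩, rfl⟩
      obtain ⟨y, rfl⟩ := hD.2 y
      exact ⟨y, by rw [hfD]⟩
    · rintro ⟨x, rfl⟩
      exact ⟨_, ⟨D x, rfl⟩, by simp only [hfD]⟩

/-- If every point has a chart in which the surface is a Lagrangian immersion of an open set of
the plane, then the surface is a Lagrangian surface with nondegenerate metric. -/
lemma isLagrangian_of_charts (h : ∀ p : M, ∃ e ∈ IsManifold.maximalAtlas (𝓡 2) ∞ M,
      p ∈ e.source ∧ IsLagrangianImmersionOn e.target (φ ∘ e.symm)) :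
    IsPseudoRiemannianImmersion φ ∧ IsLagrangian φ := by
  have hsmooth : ContMDiff (𝓡 2) 𝓘(ℝ, C21) ∞ φ := fun p => by
    obtain ⟨e, he, hp, hf⟩ := h p
    exact contMDiffAt_of_comp_symm he hp (hf.smooth _ (e.map_source hp))
  -- the tangent plane is the image of the differential of a local expression
  have key : ∀ p : M, ∃ (f : Plane → C21) (U : Set Plane) (u : Plane), u ∈ U ∧
      IsLagrangianImmersionOn U f ∧
      ∃ D : Plane →ₗ[ℝ] Plane, Function.Bijective D ∧
      ∀ y, fderiv ℝ f u y = mfderiv (𝓡 2) 𝓘(ℝ, C21) φ p (D y) := fun p => by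
    obtain ⟨e, he, hp, hf⟩ := h p
    obtain ⟨D, hD, hfD⟩ := fderiv_comp_symm he (e.map_source hp) hsmooth.contMDiffAt
    refine ⟨_, _, e p, e.map_source hp, hf, D, hD, fun y => ?_⟩
    rw [hfD]
    congr 2
    exact e.left_inv hp
  have tangent : ∀ {p : M} {f : Plane → C21} {u : Plane} {D : Plane →ₗ[ℝ] Plane},
      Function.Bijective D → (∀ y, fderiv ℝ f u y = mfderiv (𝓡 2) 𝓘(ℝ, C21) φ p (D y)) →
      tangentPlane φ p = Set.range (fderiv ℝ f u) := by
    intro p f u D hD hfD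
    ext ξ
    constructor
    · rintro ⟨y, rfl⟩
      obtain ⟨y, rfl⟩ := hD.2 y
      exact ⟨y, hfD y⟩
    · rintro ⟨y, rfl⟩
      exact ⟨D y, (hfD y).symm⟩
  refine ⟨⟨hsmooth, fun p => ?_, fun p w hw hw0 => ?_⟩, fun p => ?_⟩
  all_goals obtain ⟨f, U, u, hu, hf, D, hD, hfD⟩ := key p
  · intro x y hxy
    obtain ⟨x, rfl⟩ := hD.2 x
    obtain ⟨y, rfl⟩ := hD.2 y
    have : fderiv ℝ f u x = fderiv ℝ f u y := by rw [hfD, hfD]; exact hxy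
    rw [hf.immersive u hu this]
  · rw [tangent hD hfD] at hw hw0
    obtain ⟨x, rfl⟩ := hw
    exact hf.nondegenerate u hu x fun y => hw0 _ ⟨y, rfl⟩
  · have hN : ∀ ξ, ξ ∈ normalPlane φ p ↔ ∃ x, ξ = Complex.I • fderiv ℝ f u x := fun ξ => by
      rw [← hf.lagrangian u hu ξ, normalPlane, tangent hD hfD]
      exact ⟨fun hξ y => hξ _ ⟨y, rfl⟩, by rintro hξ _ ⟨y, rfl⟩; exact hξ y⟩
    rw [tangent hD hfD]
    constructor
    · ext ξ
      rw [hN]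
      constructor
      · rintro ⟨_, ⟨x, rfl⟩, rfl⟩
        exact ⟨x, rfl⟩
      · rintro ⟨x, rfl⟩
        exact ⟨_, ⟨x, rfl⟩, rfl⟩
    · ext ξ
      constructor
      · rintro ⟨η, hη, rfl⟩
        obtain ⟨x, rfl⟩ := (hN η).1 hη
        refine ⟨-x, ?_⟩
        simp only [smul_smul, Complex.I_mul_I, map_neg, neg_one_smul]
      · rintro ⟨x, rfl⟩
        refine ⟨_, (hN _).2 ⟨-x, rfl⟩, ?_⟩
        simp only [smul_smul, Complex.I_mul_I, map_neg, neg_one_smul, neg_neg]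

/-- Coordinate changes are smooth with injective differential. -/
lemma contDiffAt_transition (he : e ∈ IsManifold.maximalAtlas (𝓡 2) ∞ M)
    (he' : e' ∈ IsManifold.maximalAtlas (𝓡 2) ∞ M) {u : Plane} (hu : u ∈ e.target)
    (hu' : e.symm u ∈ e'.source) : ContDiffAt ℝ ∞ (e' ∘ e.symm) u :=
  contMDiffAt_iff_contDiffAt.1 ((contMDiffAt_of_mem_maximalAtlas he' hu').comp u
    (contMDiffAt_symm_of_mem_maximalAtlas he hu))

lemma injective_fderiv_transition (he : e ∈ IsManifold.maximalAtlas (𝓡 2) ∞ M)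
    (he' : e' ∈ IsManifold.maximalAtlas (𝓡 2) ∞ M) {u : Plane} (hu : u ∈ e.target)
    (hu' : e.symm u ∈ e'.source) : Function.Injective (fderiv ℝ (e' ∘ e.symm) u) := by
  have h1 := (contDiffAt_transition he he' hu hu').differentiableAt (by simp)
  have h2 : DifferentiableAt ℝ (e ∘ e'.symm) ((e' ∘ e.symm) u) :=
    (contDiffAt_transition he' he (e'.map_source hu') (by
      simpa [e'.left_inv hu'] using e.map_target hu)).differentiableAt (by simp)
  have hc := (h2.hasFDerivAt.comp u h1.hasFDerivAt).fderiv
  have hid : (e ∘ e'.symm) ∘ (e' ∘ e.symm) =ᶠ[𝓝 u] id := by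
    have hm : (e.symm ≫ₕ e').source ∈ 𝓝 u := (e.symm ≫ₕ e').open_source.mem_nhds ⟨hu, hu'⟩
    filter_upwards [hm] with v hv
    have h3 : e'.symm (e' (e.symm v)) = e.symm v := e'.left_inv hv.2
    change e (e'.symm (e' (e.symm v))) = v
    rw [h3, e.right_inv hv.1]
  rw [hid.fderiv_eq, fderiv_id] at hc
  refine Function.LeftInverse.injective (g := fderiv ℝ (e ∘ e'.symm) ((e' ∘ e.symm) u)) fun y => ?_
  exact (congrArg (fun L : Plane →L[ℝ] Plane => L y) hc).symm

theorem locallyCongruentToModel_of_isQBMTLagrangian [IsManifold (𝓡 2) ∞ M]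
    (h : IsQBMTLagrangian φ) :
    LocallyCongruentToModel φ := by
  intro p
  have hc := IsManifold.chart_mem_maximalAtlas (I := 𝓡 2) (n := ∞) p
  have hp := mem_chart_source Plane p
  generalize chartAt Plane p = e at hc hp
  have hL := isLagrangianImmersionOn_comp_symm h.immersion h.lagrangian hc
  obtain ⟨U, hU, hpU, e₁, e₂, a, b, hF⟩ := hL.exists_isMeanCurvatureFrameOn
    (h.marginallyTrapped e hc) (e.map_source hp)
  obtain ⟨w, lam, m, hA⟩ := hF.exists_isAdaptedFrameOn
  have hb := fun v (hv : v ∈ U) =>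
    (hA.lightlike_bitension_iff hv).1 (h.quasiBiharmonic e hc v (hU hv))
  obtain ⟨ψ, hpψ, hψU, hs, hs', I, z, c, hz, hψ⟩ :=
    hA.exists_normal_form (fun v hv => (hb v hv).1) (fun v hv => (hb v hv).2) hpU
  refine ⟨e ≫ₕ ψ, ?_, ?_, 1, I, z, fun v => v + c, one_ne_zero, hz,
    ⟨LinearEquiv.refl ℂ C21, c, fun v w => rfl, fun v => rfl⟩, fun u hu => ?_⟩
  · apply OpenPartialHomeomorph.mem_maximalAtlas_of_contMDiffOn
    · intro q hq
      rw [OpenPartialHomeomorph.trans_source] at hq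
      exact ((contMDiffAt_iff_contDiffAt.2 (hs _ hq.2)).comp q
        (contMDiffAt_of_mem_maximalAtlas hc hq.1)).contMDiffWithinAt
    · intro x hx
      rw [OpenPartialHomeomorph.trans_target] at hx
      exact ((contMDiffAt_symm_of_mem_maximalAtlas hc hx.2).comp x
        (contMDiffAt_iff_contDiffAt.2 (hs' _ hx.1))).contMDiffWithinAt
  · rw [OpenPartialHomeomorph.trans_source]
    exact ⟨hp, hpψ⟩
  · rw [OpenPartialHomeomorph.trans_target] at hu
    exact hψ u hu.1

theorem isQBMTLagrangian_of_locallyCongruentToModel (h : LocallyCongruentToModel φ) :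
    IsQBMTLagrangian φ := by
  -- an adapted frame around each point of each chart
  have key : ∀ e ∈ IsManifold.maximalAtlas (𝓡 2) ∞ M, ∀ e' ∈ IsManifold.maximalAtlas (𝓡 2) ∞ M,
      ∀ (μ : ℝ) (I : Set ℝ) (z : ℝ → C21) (A : C21 → C21),
      μ ≠ 0 → IsGeneratingCurve μ I z → IsHolomorphicIsometry A →
      (∀ u ∈ e'.target, u 0 ∈ I ∧ φ (e'.symm u) = A (model μ z u)) →
      ∃ e₁ e₂ p q lam, IsAdaptedFrameOn (e.symm ≫ₕ e').source (φ ∘ e.symm) e₁ e₂ p q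
        (fun _ => 0) lam (fun _ => 0) ∧ ∀ v ∈ (e.symm ≫ₕ e').source, lam v ≠ 0 := by
    intro e he e' he' μ I z A hμ hz hA hφ
    obtain ⟨T, b, hT, hinj, hAT⟩ := hA.exists_eq
    refine (hz.map T hT hinj).isAdaptedFrameOn (ψ := e' ∘ e.symm) (b := b) hμ
      (e.symm ≫ₕ e').open_source (fun v hv => contDiffAt_transition he he' hv.1 hv.2)
      (fun v hv => injective_fderiv_transition he he' hv.1 hv.2)
      (fun v hv => (hφ _ (e'.map_source hv.2)).1) (fun v hv => ?_)
    have hv' : e.symm v ∈ e'.source := hv.2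
    have h1 := (hφ _ (e'.map_source hv')).2
    have h2 : e'.symm (e' (e.symm v)) = e.symm v := e'.left_inv hv'
    rw [h2, hAT] at h1
    rw [Function.comp_apply, h1]
    simp [model]
  have hI := isLagrangian_of_charts (φ := φ) fun p => by
    obtain ⟨e', he', hp, μ, I, z, A, hμ, hz, hA, hφ⟩ := h p
    refine ⟨e', he', hp, ?_⟩
    obtain ⟨e₁, e₂, a, b, lam, hF, -⟩ := key e' he' e' he' μ I z A hμ hz hA hφ
    have hsrc : (e'.symm ≫ₕ e').source = e'.target := by
      rw [OpenPartialHomeomorph.trans_source, OpenPartialHomeomorph.symm_source]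
      exact Set.inter_eq_left.2 fun u hu => e'.map_target hu
    rw [← hsrc]
    exact hF.isLagrangianImmersionOn
  refine ⟨hI.1, hI.2, fun e he u hu => ?_, fun e he u hu => ?_⟩
  all_goals
    obtain ⟨e', he', hp, μ, I, z, A, hμ, hz, hA, hφ⟩ := h (e.symm u)
    obtain ⟨e₁, e₂, a, b, lam, hF, hlam⟩ := key e he e' he' μ I z A hμ hz hA hφ
    have hu' : u ∈ (e.symm ≫ₕ e').source := ⟨hu, hp⟩
  · exact hF.lightlike_meanCurvature hu'
  · exact (hF.lightlike_bitension_iff hu').2 ⟨hlam u hu', rfl⟩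

end Manifold

/-- A model surface over an open set of the plane is congruent to itself in the coordinates of
the plane. -/
lemma locallyCongruentToModel_model {μ : ℝ} {I : Set ℝ} {z : ℝ → C21} (hμ : μ ≠ 0)
    (hz : IsGeneratingCurve μ I z) (S : TopologicalSpace.Opens Plane) (hS : ∀ u ∈ S, u 0 ∈ I) :
    LocallyCongruentToModel (fun u : S => model μ z u) := by
  intro p
  have hval : ∀ q : S, chartAt Plane p q = q.1 := fun q => by
    rw [TopologicalSpace.Opens.chartAt_eq]
    rfl
  refine ⟨chartAt Plane p, IsManifold.chart_mem_maximalAtlas p, mem_chart_source Plane p, μ, I, z,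
    id, hμ, hz, ⟨LinearEquiv.refl ℂ C21, 0, fun v w => rfl, fun v => by simp⟩, fun u hu => ?_⟩
  have hu' : (((chartAt Plane p).symm u : S) : Plane) = u := by
    rw [← hval, (chartAt Plane p).right_inv hu]
  constructor
  · rw [← hu']
    exact hS _ ((chartAt Plane p).symm u).2
  · simp only [hu', id]

end LorentzSurface
end

theorem theorem7 :
    (∀ (M : Type*) [TopologicalSpace M] [ChartedSpace LorentzSurface.Plane M]
        [IsManifold (𝓡 2) ∞ M] (φ : M → LorentzSurface.C21),
      LorentzSurface.IsQBMTLagrangian φ ↔ LorentzSurface.LocallyCongruentToModel φ) ∧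
    (∀ (μ : ℝ) (I : Set ℝ) (z : ℝ → LorentzSurface.C21), μ ≠ 0 →
      LorentzSurface.IsGeneratingCurve μ I z →
      ∀ S : TopologicalSpace.Opens LorentzSurface.Plane, (∀ u ∈ S, u 0 ∈ I) →
        LorentzSurface.IsQBMTLagrangian (fun u : S => LorentzSurface.model μ z u)) :=
  ⟨fun _ _ _ _ _ => ⟨LorentzSurface.locallyCongruentToModel_of_isQBMTLagrangian,
    LorentzSurface.isQBMTLagrangian_of_locallyCongruentToModel⟩,
  fun _ _ _ hμ hz S hS => LorentzSurface.isQBMTLagrangian_of_locallyCongruentToModel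
    (LorentzSurface.locallyCongruentToModel_model hμ hz S hS)⟩
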